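/- Let $X$ be a complex vector space with a locally convex topology $\tau$ and a norm $\|\cdot\|$, and let $\mathcal N$ be the set of $\tau$-continuous semi-norms $p$ with $p(x)\le\|x\|$ for all $x\in X$. Assume that $(X,\tau,\|\cdot\|)$ is of type B, i.e. (i) $(X,\tau)$ is sequentially complete, (ii) $\tau$ is weaker than the norm topology, (iii) $\tau$ and the norm topology have the same bounded sets, and (iv) $\mathcal N$ is countably convex: if $p_k\in\mathcal N$, $\alpha_k\ge 0$ and $\sum_k\alpha_k=1$, then $\sum_k\alpha_k p_k\in\mathcal N$. A strongly continuous semigroup is a family $\{T(t)\}_{t\ge0}$ of $\tau$-continuous linear operators on $X$ with $T(0)=\mathbb 1$, $T(t+s)=T(t)T(s)$ and $t\mapsto T(t)x$ $\tau$-continuous for every $x\in X$. Its generator is $Ax=\tau\text{-}\lim_{t\downarrow0}(T(t)x-x)/t$, with domain the set of all $x$ for which the limit exists. It is of type $(M,\omega)^*$ if for every $p\in\mathcal N$ there is $q\in\mathcal N$ with $\sup_{t\ge0}e^{-\omega t}p(T(t)x)\le Mq(x)$ for all $x\in X$. It is quasi equi-continuous if there is $\omega\in\mathbb R$ such that for every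 continuous semi-norm $p$ there is a continuous semi-norm $q$ with $\sup_{t\ge0}e^{-\omega t}p(T(t)x)\le q(x)$ for all $x\in X$. For a linear operator $(A,\mathcal D(A))$ on $X$, $\rho(A)$ is the set of $\lambda\in\mathbb C$ such that $\lambda-A:\mathcal D(A)\to X$ is bijective, and $R(\lambda)=(\lambda-A)^{-1}$ for $\lambda\in\rho(A)$. $A$ is closed if its graph is closed in $X\times X$ for the product topology. **Theorem.** Let $(X,\tau,\|\cdot\|)$ be of type B, let $(A,\mathcal D(A))$ be a linear operator on $X$, and let $M\ge1$, $\omega\in\mathbb R$. The following are equivalent. (a) $(A,\mathcal D(A))$ generates a strongly continuous semigroup of type $(M,\omega)^*$. (b) $(A,\mathcal D(A))$ is closed and densely defined, every real $\lambda>\omega$ lies in $\rho(A)$, and for every $p\in\mathcal N$ there is $q\in\mathcal N$ such that for all $x\in X$ $$\sup_{n\ge1}\ \sup_{\lambda>\omega}\ p\Big(\big(n(\lambda-\omega)\,R(\omega+n(\lambda-\omega))\big)^n x\Big)\le M q(x).$$ (c) $(A,\mathcal D(A))$ is closed and densely defined, every $\lambda\in\mathbb C$ with $\operatorname{Re}\lambda>\omega$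 lies in $\rho(A)$, and for every $p\in\mathcal N$ there is $q\in\mathcal N$ such that for all $x\in X$ $$\sup_{n\ge1}\ \sup_{\operatorname{Re}\lambda>\omega}\ p\Big(\big(n(\operatorname{Re}\lambda-\omega)\,R(\omega+n(\lambda-\omega))\big)^n x\Big)\le M q(x).$$ Consequently, (a), (b) and (c), each read with "there exist $M\ge1$ and $\omega\in\mathbb R$", are equivalent to each other, and also to: $(A,\mathcal D(A))$ generates a strongly continuous quasi equi-continuous semigroup. -/

import Mathlib

open Filter Topology
open scoped NNReal

noncomputable section

namespace LCSemigroup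

section TypeB

variable {X : Type*} [AddCommGroup X] [Module ℂ X] [UniformSpace X]

/-- The set `𝒩`: the semi-norms that are continuous for the locally convex topology `τ` of `X`
and are dominated by the auxiliary norm `ν`. -/
def contSeminorms (ν : Seminorm ℂ X) : Set (Seminorm ℂ X) :=
  {p | Continuous p ∧ ∀ x, p x ≤ ν x}

/-- `𝒩` is closed under countable convex combinations. -/
def CountablyConvex (ν : Seminorm ℂ X) : Prop :=
  ∀ (p : ℕ → Seminorm ℂ X) (α : ℕ → ℝ), (∀ n, p n ∈ contSeminorms ν) → (∀ n, 0 ≤ α n) →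
    HasSum α 1 → ∃ q ∈ contSeminorms ν, ∀ x, HasSum (fun n => α n * p n x) (q x)

/-- The locally convex space `X` (whose uniform structure is the one of its topology `τ`) together
with the auxiliary norm `ν` is of type B. -/
structure IsTypeB (ν : Seminorm ℂ X) : Prop where
  /-- `ν` is a norm. -/
  eq_zero_of_norm_eq_zero : ∀ x, ν x = 0 → x = 0
  /-- `(X, τ)` is sequentially complete. -/
  seq_complete : ∀ u : ℕ → X, CauchySeq u → ∃ x, Tendsto u atTop (𝓝 x)
  /-- `τ` is weaker than the norm topology. -/
  weaker : ∀ U ∈ 𝓝 (0 : X), ∃ r > 0, ν.ball 0 r ⊆ U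
  /-- `τ` and the norm have the same bounded sets. -/
  bounded_iff : ∀ s : Set X, Bornology.IsVonNBounded ℂ s ↔ ∃ C : ℝ, ∀ x ∈ s, ν x ≤ C
  /-- `𝒩` is countably convex. -/
  countably_convex : CountablyConvex ν

end TypeB

section Semigroup

variable {X : Type*} [AddCommGroup X] [Module ℂ X] [UniformSpace X]

/-- A strongly continuous semigroup of `τ`-continuous linear operators. -/
structure IsStronglyContinuousSemigroup (T : ℝ≥0 → X →L[ℂ] X) : Prop where
  map_zero : T 0 = ContinuousLinearMap.id ℂ X
  map_add : ∀ s t, T (s + t) = (T s).comp (T t)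
  continuous_orbit : ∀ x, Continuous fun t => T t x

/-- `(A, 𝒟(A))` is the generator of `T`: one has `x ∈ 𝒟(A)` and `A x = y` exactly when
`(T(t) x - x) / t → y` as `t ↓ 0`. -/
def IsGenerator (A : X →ₗ.[ℂ] X) (T : ℝ≥0 → X →L[ℂ] X) : Prop :=
  ∀ x y, (x, y) ∈ A.graph ↔
    Tendsto (fun t : ℝ≥0 => (((t : ℝ) : ℂ)⁻¹) • (T t x - x)) (𝓝[>] 0) (𝓝 y)

/-- `T` is of type `(M, ω)^*`. -/
def IsTypeStar (ν : Seminorm ℂ X) (M ω : ℝ) (T : ℝ≥0 → X →L[ℂ] X) : Prop :=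
  ∀ p ∈ contSeminorms ν, ∃ q ∈ contSeminorms ν, ∀ (x : X) (t : ℝ≥0),
    Real.exp (-ω * t) * p (T t x) ≤ M * q x

/-- `T` is quasi equi-continuous. -/
def IsQuasiEquicontinuous (T : ℝ≥0 → X →L[ℂ] X) : Prop :=
  ∃ ω : ℝ, ∀ p : Seminorm ℂ X, Continuous p → ∃ q : Seminorm ℂ X, Continuous q ∧
    ∀ (x : X) (t : ℝ≥0), Real.exp (-ω * t) * p (T t x) ≤ q x

/-- `A` generates a strongly continuous semigroup of type `(M, ω)^*`. -/
def GeneratesTypeStar (ν : Seminorm ℂ X) (A : X →ₗ.[ℂ] X) (M ω : ℝ) : Prop :=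
  ∃ T : ℝ≥0 → X →L[ℂ] X, IsStronglyContinuousSemigroup T ∧ IsTypeStar ν M ω T ∧ IsGenerator A T

/-- `A` generates a strongly continuous quasi equi-continuous semigroup. -/
def GeneratesQuasiEquicontinuous (A : X →ₗ.[ℂ] X) : Prop :=
  ∃ T : ℝ≥0 → X →L[ℂ] X, IsStronglyContinuousSemigroup T ∧ IsQuasiEquicontinuous T ∧
    IsGenerator A T

end Semigroup

section Resolvent

variable {X : Type*} [AddCommGroup X] [Module ℂ X]

/-- The operator `z - A : 𝒟(A) → X`. -/
def shifted (A : X →ₗ.[ℂ] X) (z : ℂ) : A.domain →ₗ[ℂ] X :=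
  z • A.domain.subtype - A.toFun

/-- The resolvent set `ρ(A)`: all `z` such that `z - A : 𝒟(A) → X` is bijective. -/
def resolventSet (A : X →ₗ.[ℂ] X) : Set ℂ :=
  {z | Function.Bijective (shifted A z)}

open Classical in
/-- The resolvent `R(z, A) = (z - A)⁻¹ : X → X` for `z ∈ ρ(A)` (and `0` otherwise). -/
def resolvent (A : X →ₗ.[ℂ] X) (z : ℂ) : X →ₗ[ℂ] X :=
  if h : Function.Bijective (shifted A z) then
    A.domain.subtype ∘ₗ (LinearEquiv.ofBijective (shifted A z) h).symm.toLinearMap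
  else 0

end Resolvent

section Conditions

variable {X : Type*} [AddCommGroup X] [Module ℂ X] [UniformSpace X]

/-- The Hille-Yosida condition on the half line `(ω, ∞)` with one semi-norm `q` for all `λ > ω`. -/
def RealHilleYosida (ν : Seminorm ℂ X) (A : X →ₗ.[ℂ] X) (M ω : ℝ) : Prop :=
  A.IsClosed ∧ Dense (A.domain : Set X) ∧
  (∀ l : ℝ, ω < l → (l : ℂ) ∈ resolventSet A) ∧
  ∀ p ∈ contSeminorms ν, ∃ q ∈ contSeminorms ν, ∀ (x : X) (n : ℕ) (l : ℝ), 1 ≤ n → ω < l →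
    p (((((n * (l - ω) : ℝ) : ℂ) • resolvent A ((ω + n * (l - ω) : ℝ) : ℂ)) ^ n) x) ≤ M * q x

/-- The Hille-Yosida condition on the half plane `Re λ > ω` with one semi-norm `q` for all such
`λ`. -/
def ComplexHilleYosida (ν : Seminorm ℂ X) (A : X →ₗ.[ℂ] X) (M ω : ℝ) : Prop :=
  A.IsClosed ∧ Dense (A.domain : Set X) ∧
  (∀ l : ℂ, ω < l.re → l ∈ resolventSet A) ∧
  ∀ p ∈ contSeminorms ν, ∃ q ∈ contSeminorms ν, ∀ (x : X) (n : ℕ) (l : ℂ), 1 ≤ n → ω < l.re →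
    p (((((n * (l.re - ω) : ℝ) : ℂ) • resolvent A ((ω : ℂ) + n * (l - ω))) ^ n) x) ≤ M * q x

end Conditions

end LCSemigroup

end

namespace LCSemigroup

/-! ### Continuous seminorms, the norm, and rescaling into `𝒩` -/

section Seminorms

/-! Everything is estimated seminorm by seminorm, with Riemann sums and dyadic Euler steps in place
of integrals.

From semigroup to resolvent: for `p ∈ 𝒩` with bound `M q`, put `r x = sup_t e^{-ωt} p(T(t)x)`. Then
`p ≤ r ≤ M q` and `r(T(t)x) ≤ e^{ωt} r x`, so the generator is dissipative for `r`: `(Re l - ω) r x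
≤ r(l x - A x)` (`dissipative_of_contractive`). Hence `l - A` is injective and each factor `n (Re λ
- ω) R(ω + n(λ - ω))` is an `r`-contraction; powers cost nothing and the constant stays `M`.
Surjectivity comes from `y = ∫₀^∞ e^{-ls} T(s)x ds`, built as a limit of Riemann sums
(`cauchySeq_riemannSum`, `exists_generator_eq_neg`).

From resolvent to semigroup: with `B = A - ω` and `J n = (1 - 2⁻ⁿB)⁻¹`, the semigroup of `B` is the
backward Euler limit of `J n ^ ⌊t 2ⁿ⌋`. On `D(B²)` the operators `J n` and `J (n+1) ^ 2` differ by
`O(4⁻ⁿ)`, so about `t 2ⁿ` steps accumulate only `O(2⁻ⁿ)`; density and equicontinuity do the rest.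
Multiplying by `e^{ωt}` gives a semigroup whose generator extends `A`, and equality follows because
`l - A` is onto while `l` minus the generator is injective.

Quasi equi-continuity matches type `(M, ω)^*` because `τ` and the norm have the same bounded sets:
the weighted orbits of the unit ball are norm bounded, and their bound supplies `M`. -/

open scoped ComplexOrder in
theorem polynormableSpace_of_locallyConvexSpace_real {X : Type*} [AddCommGroup X] [Module ℂ X]
    [TopologicalSpace X] [IsTopologicalAddGroup X] [ContinuousSMul ℂ X] [LocallyConvexSpace ℝ X] :
    PolynormableSpace ℂ X := by
  -- The nonnegative elements of `ℂ` are the nonnegative reals, so convexity over `ℝ` and over `ℂ`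
  -- coincide.
  have : LocallyConvexSpace ℂ X := ⟨fun x =>
    (LocallyConvexSpace.convex_basis (𝕜 := ℝ) x).to_hasBasis
      (fun s hs => ⟨s, ⟨hs.1, convex_of_nonneg_surjective_algebraMap ℂ
        (fun z hz => RCLike.nonneg_iff_exists_ofReal.mp (Set.mem_Ici.1 hz)) hs.2⟩, subset_rfl⟩)
      fun s hs => ⟨s, ⟨hs.1, hs.2.lift ℝ⟩, subset_rfl⟩⟩
  have : ContinuousSMul ℝ X := IsScalarTower.continuousSMul ℂ
  exact (with_gaugeSeminormFamily (𝕜 := ℂ)).toPolynormableSpace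

variable {X : Type*} [AddCommGroup X] [Module ℂ X] [UniformSpace X]

theorem tendsto_iff_forall_seminorm [PolynormableSpace ℂ X] {ι : Type*} {u : ι → X}
    {l : Filter ι} {x : X} :
    Tendsto u l (𝓝 x) ↔ ∀ p : Seminorm ℂ X, Continuous p →
      ∀ ε > 0, ∀ᶠ i in l, p (u i - x) < ε := by
  rw [(PolynormableSpace.withSeminorms ℂ X).tendsto_nhds]
  exact ⟨fun h p hp => h ⟨p, hp⟩, fun h p => h p.1 p.2⟩

theorem seminorm_le_of_tendsto {p : Seminorm ℂ X} (hp : Continuous p) {ι : Type*} {l : Filter ι}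
    [l.NeBot] {u : ι → X} {x : X} (hu : Tendsto u l (𝓝 x)) {c : ι → ℝ} {C : ℝ}
    (hc : Tendsto c l (𝓝 C)) (h : ∀ᶠ i in l, p (u i) ≤ c i) : p x ≤ C :=
  le_of_tendsto_of_tendsto ((hp.tendsto x).comp hu) hc h

theorem mem_closure_iff_forall_seminorm [IsUniformAddGroup X] [PolynormableSpace ℂ X]
    {s : Set X} {x : X} :
    x ∈ closure s ↔ ∀ p : Seminorm ℂ X, Continuous p → ∀ ε > 0, ∃ y ∈ s, p (y - x) < ε := by
  rw [mem_closure_iff_nhds_basis (PolynormableSpace.withSeminorms ℂ X).hasBasis_ball]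
  constructor
  · intro h p hp ε hε
    obtain ⟨y, hy, hy'⟩ := h (i := ({⟨p, hp⟩}, ε)) hε
    exact ⟨y, hy, by simpa [Seminorm.mem_ball] using hy'⟩
  · rintro h ⟨s, ε⟩ hε
    obtain ⟨y, hy, hy'⟩ := h (s.sup fun p : {p : Seminorm ℂ X // Continuous p} ↦ p.1)
      (Seminorm.continuous_finsetSup fun i _ => i.2) ε hε
    exact ⟨y, hy, by simpa [Seminorm.mem_ball] using hy'⟩

theorem continuous_of_forall_seminorm [IsUniformAddGroup X] [PolynormableSpace ℂ X]
    (f : X →ₗ[ℂ] X)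
    (hf : ∀ p : Seminorm ℂ X, Continuous p → ∃ q : Seminorm ℂ X, Continuous q ∧
      ∀ x, p (f x) ≤ q x) : Continuous f := by
  refine WithSeminorms.continuous_of_continuous_comp (PolynormableSpace.withSeminorms ℂ X) f ?_
  rintro ⟨p, hp⟩
  obtain ⟨q, hq, hpq⟩ := hf p hp
  exact Seminorm.continuous_of_le hq hpq

theorem cauchySeq_of_forall_seminorm [IsUniformAddGroup X] [PolynormableSpace ℂ X] {u : ℕ → X}
    (hu : ∀ p : Seminorm ℂ X, Continuous p → ∀ ε > 0, ∃ N, ∀ n ≥ N, ∀ m ≥ N,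
      p (u m - u n) < ε) : CauchySeq u := by
  rw [cauchySeq_iff_tendsto, uniformity_eq_comap_nhds_zero, tendsto_comap_iff,
    tendsto_iff_forall_seminorm]
  intro p hp ε hε
  obtain ⟨N, hN⟩ := hu p hp ε hε
  filter_upwards [eventually_ge_atTop (N, N)] with i hi
  simpa using hN i.1 hi.1 i.2 hi.2

theorem cauchySeq_of_seminorm_le_geometric [IsUniformAddGroup X] [PolynormableSpace ℂ X]
    {u : ℕ → X}
    (hu : ∀ p : Seminorm ℂ X, Continuous p → ∃ C : ℝ, ∀ n, p (u (n + 1) - u n) ≤ C * (1 / 2) ^ n) :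
    CauchySeq u := by
  refine cauchySeq_of_forall_seminorm fun p hp ε hε => ?_
  obtain ⟨C, hC⟩ := hu p hp
  have hC0 : 0 ≤ C := by simpa using (apply_nonneg p _).trans (hC 0)
  have key : ∀ n k, p (u (n + k) - u n) ≤ 2 * C * ((1 / 2) ^ n - (1 / 2) ^ (n + k)) := by
    intro n k
    induction k with
    | zero => simp
    | succ k ih =>
      have h1 := map_add_le_add p (u (n + (k + 1)) - u (n + k)) (u (n + k) - u n)
      rw [sub_add_sub_cancel] at h1
      have h2 := hC (n + k)
      rw [← add_assoc] at *
      rw [pow_succ _ (n + k)]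
      linarith
  have hlim : Tendsto (fun n : ℕ => 2 * C * (1 / 2 : ℝ) ^ n) atTop (𝓝 (2 * C * 0)) :=
    (tendsto_pow_atTop_nhds_zero_of_lt_one (by norm_num) (by norm_num)).const_mul _
  rw [mul_zero] at hlim
  obtain ⟨N, hN⟩ := eventually_atTop.1 (hlim.eventually (gt_mem_nhds hε))
  have main : ∀ n ≥ N, ∀ m ≥ n, p (u m - u n) < ε := by
    intro n hn m hm
    obtain ⟨k, rfl⟩ := Nat.exists_eq_add_of_le hm
    have h1 := key n k
    have h2 := hN n hn
    have h3 : 0 ≤ 2 * C * (1 / 2 : ℝ) ^ (n + k) := by positivity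
    linarith
  refine ⟨N, fun n hn m hm => ?_⟩
  rcases le_total n m with h | h
  · exact main n hn m h
  · rw [map_sub_rev]
    exact main m hm n h

theorem exists_le_mul_norm [IsUniformAddGroup X] {ν : Seminorm ℂ X} (hν : IsTypeB ν)
    {p : Seminorm ℂ X} (hp : Continuous p) : ∃ C : ℝ, 0 < C ∧ ∀ x, p x ≤ C * ν x := by
  obtain ⟨r, hr, hball⟩ := hν.weaker {x | p x < 1}
    ((isOpen_lt hp continuous_const).mem_nhds (by simp))
  refine ⟨2 / r, by positivity, fun x => ?_⟩
  rcases (apply_nonneg ν x).eq_or_lt with h0 | h0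
  · simp [hν.eq_zero_of_norm_eq_zero x h0.symm]
  · have h1 : ((r / (2 * ν x) : ℝ) : ℂ) • x ∈ ν.ball 0 r := by
      rw [Seminorm.mem_ball_zero, map_smul_eq_mul, Complex.norm_real,
        Real.norm_of_nonneg (by positivity)]
      field_simp
      linarith
    have h2 : p (((r / (2 * ν x) : ℝ) : ℂ) • x) < 1 := hball h1
    rw [map_smul_eq_mul, Complex.norm_real, Real.norm_of_nonneg (by positivity)] at h2
    field_simp at h2 ⊢
    linarith

theorem exists_norm_le_of_forall_seminorm [PolynormableSpace ℂ X] [ContinuousSMul ℂ X]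
    {ν : Seminorm ℂ X} (hν : IsTypeB ν) {s : Set X}
    (hs : ∀ p : Seminorm ℂ X, Continuous p → ∃ C : ℝ, ∀ x ∈ s, p x ≤ C) :
    ∃ C : ℝ, ∀ x ∈ s, ν x ≤ C := by
  rw [← hν.bounded_iff, (PolynormableSpace.withSeminorms ℂ X).isVonNBounded_iff_seminorm_bounded]
  rintro ⟨p, hp⟩
  obtain ⟨C, hC⟩ := hs p hp
  exact ⟨max C 0 + 1, by positivity, fun x hx => (hC x hx).trans_lt (by
    linarith [le_max_left C 0])⟩

/-- All multiples of such an `x` form a `τ`-bounded set, hence a norm bounded one, which forces `ν x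
= 0`. This makes `τ` Hausdorff. -/
theorem eq_zero_of_forall_seminorm [PolynormableSpace ℂ X] [ContinuousSMul ℂ X] {ν : Seminorm ℂ X}
    (hν : IsTypeB ν) {x : X} (hx : ∀ p : Seminorm ℂ X, Continuous p → p x = 0) : x = 0 := by
  obtain ⟨C, hC⟩ := exists_norm_le_of_forall_seminorm hν (s := Set.range fun n : ℕ => (n : ℂ) • x)
    fun p hp => ⟨0, by rintro _ ⟨n, rfl⟩; simp [map_smul_eq_mul, hx p hp]⟩
  refine hν.eq_zero_of_norm_eq_zero x (le_antisymm ?_ (apply_nonneg _ _))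
  by_contra! h
  obtain ⟨n, hn⟩ := exists_nat_gt (C / ν x)
  have := hC _ ⟨n, rfl⟩
  rw [map_smul_eq_mul, Complex.norm_natCast] at this
  rw [div_lt_iff₀ h] at hn
  linarith

theorem IsTypeB.t2Space [IsUniformAddGroup X] [PolynormableSpace ℂ X] [ContinuousSMul ℂ X]
    {ν : Seminorm ℂ X} (hν : IsTypeB ν) : T2Space X := by
  have : T1Space X := (PolynormableSpace.withSeminorms ℂ X).T1_of_separating fun x hx => by
    by_contra! h
    exact hx (eq_zero_of_forall_seminorm hν fun p hp => h ⟨p, hp⟩)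
  infer_instance

/-- Lets estimates known only on `𝒩` pass to every continuous seminorm. -/
theorem exists_smul_mem_contSeminorms [IsUniformAddGroup X] [ContinuousSMul ℂ X] {ν : Seminorm ℂ X}
    (hν : IsTypeB ν) {p : Seminorm ℂ X} (hp : Continuous p) :
    ∃ C : ℝ≥0, 0 < C ∧ C⁻¹ • p ∈ contSeminorms ν := by
  obtain ⟨C, hC, h⟩ := exists_le_mul_norm hν hp
  refine ⟨⟨C, hC.le⟩, hC, hp.const_smul _, fun x => ?_⟩
  change C⁻¹ * p x ≤ ν x
  rw [inv_mul_le_iff₀ hC]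
  exact h x

theorem exists_iSup_seminorm [IsUniformAddGroup X] {ι : Type*} [Nonempty ι]
    (P : ι → Seminorm ℂ X) {q : Seminorm ℂ X} (hq : Continuous q) (h : ∀ i x, P i x ≤ q x) :
    ∃ r : Seminorm ℂ X, Continuous r ∧ (∀ i x, P i x ≤ r x) ∧
      ∀ x (c : ℝ), (∀ i, P i x ≤ c) → r x ≤ c := by
  have hb : BddAbove (Set.range P) := ⟨q, by rintro _ ⟨i, rfl⟩; exact h i⟩
  exact ⟨⨆ i, P i, Seminorm.continuous_of_le hq (ciSup_le h), fun i x => le_ciSup hb i x,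
    fun x c hc => by rw [Seminorm.iSup_apply hb]; exact ciSup_le hc⟩

end Seminorms

/-! ### Convergence of the backward Euler scheme -/

section BackwardEuler

variable {X : Type*} [AddCommGroup X] [Module ℂ X]

theorem seminorm_inv_two_pow_smul (p : Seminorm ℂ X) (n : ℕ) (x : X) :
    p (((2 : ℂ) ^ n)⁻¹ • x) = (1 / 2) ^ n * p x := by
  rw [map_smul_eq_mul]
  simp

/-- Telescoping: `U^k - V^k` is the sum of the `U^i (U - V) V^j` with `i + j = k - 1`. The induction
carries arbitrary outer powers, and `U` and `V` need not commute. -/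
theorem seminorm_pow_sub_pow_le (p : Seminorm ℂ X) (U V : Module.End ℂ X) (x : X) {ε : ℝ}
    (h : ∀ i j : ℕ, p ((U ^ i) (U ((V ^ j) x) - V ((V ^ j) x))) ≤ ε) (k : ℕ) :
    p ((U ^ k) x - (V ^ k) x) ≤ k * ε := by
  have key : ∀ k i j : ℕ, p ((U ^ i) ((U ^ k) ((V ^ j) x) - (V ^ k) ((V ^ j) x))) ≤ k * ε := by
    intro k
    induction k with
    | zero => simp
    | succ k ih =>
      intro i j
      have h1 := h (i + k) j
      have h2 := ih i (j + 1)
      have h3 : (U ^ i) ((U ^ (k + 1)) ((V ^ j) x) - (V ^ (k + 1)) ((V ^ j) x)) =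
          (U ^ (i + k)) (U ((V ^ j) x) - V ((V ^ j) x)) +
          (U ^ i) ((U ^ k) ((V ^ (j + 1)) x) - (V ^ k) ((V ^ (j + 1)) x)) := by
        rw [pow_succ' V j, pow_add U i k, pow_succ U k, pow_succ V k]
        simp
      rw [h3]
      refine (map_add_le_add p _ _).trans ?_
      push_cast
      linarith
  simpa using key k 0 0

/-- `J n` plays the role of the resolvent `(1 - 2⁻ⁿ B)⁻¹` of the operator `B` with graph `Γ`. -/
structure IsResolventSequence [UniformSpace X] (Γ : X → X → Prop) (J : ℕ → Module.End ℂ X) :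
    Prop where
  graph : ∀ n x, Γ (J n x) ((2 : ℂ) ^ n • (J n x - x))
  apply_eq : ∀ n x y, Γ x y → J n x = x + ((2 : ℂ) ^ n)⁻¹ • J n y
  equicontinuous : ∀ p : Seminorm ℂ X, Continuous p → ∃ q : Seminorm ℂ X, Continuous q ∧
    ∀ n k x, p ((J n ^ k) x) ≤ q x
  dense : Dense {x | ∃ y, Γ x y}

variable [UniformSpace X] {Γ : X → X → Prop} {J : ℕ → Module.End ℂ X}

namespace IsResolventSequence

/-- The resolvent commutes with the operator. -/
theorem graph_apply (h : IsResolventSequence Γ J) {x y : X} (hxy : Γ x y) (n : ℕ) :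
    Γ (J n x) (J n y) := by
  have := h.graph n x
  rwa [h.apply_eq n x y hxy, add_sub_cancel_left, smul_inv_smul₀ (pow_ne_zero _ two_ne_zero),
    ← h.apply_eq n x y hxy] at this

theorem graph_pow (h : IsResolventSequence Γ J) {x y : X} (hxy : Γ x y) (n k : ℕ) :
    Γ ((J n ^ k) x) ((J n ^ k) y) := by
  induction k with
  | zero => simpa
  | succ k ih => simpa [pow_succ'] using h.graph_apply ih n

theorem apply_le (h : IsResolventSequence Γ J) {p : Seminorm ℂ X} (hp : Continuous p) :
    ∃ q : Seminorm ℂ X, Continuous q ∧ (∀ x, p x ≤ q x) ∧ ∀ n k x, p ((J n ^ k) x) ≤ q x := by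
  obtain ⟨q, hq, hpq⟩ := h.equicontinuous p hp
  exact ⟨q, hq, fun x => by simpa using hpq 0 0 x, hpq⟩

theorem pow_sub_self_le (h : IsResolventSequence Γ J) {p : Seminorm ℂ X} (hp : Continuous p) :
    ∃ q : Seminorm ℂ X, Continuous q ∧ ∀ x y, Γ x y → ∀ n k : ℕ,
      p ((J n ^ k) x - x) ≤ k * ((1 / 2) ^ n * q y) := by
  obtain ⟨q, hq, -, hpq⟩ := h.apply_le hp
  refine ⟨q, hq, fun x y hxy n k => ?_⟩
  have := seminorm_pow_sub_pow_le p (J n) 1 x (ε := (1 / 2) ^ n * q y) (fun i j => by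
    simp only [one_pow, Module.End.one_apply]
    rw [h.apply_eq n x y hxy, add_sub_cancel_left, map_smul, seminorm_inv_two_pow_smul]
    gcongr
    exact hpq n (i + 1) y) k
  simpa using this

/-- One step of length `h` and two of length `h/2` agree to first order in `h`, so on the domain of
the square they differ by `O(h²)`; the error is then telescoped over `k` steps. -/
theorem pow_sub_pow_succ_le (h : IsResolventSequence Γ J) {p : Seminorm ℂ X} (hp : Continuous p) :
    ∃ q : Seminorm ℂ X, Continuous q ∧ ∀ x y z, Γ x y → Γ y z → ∀ n k : ℕ,
      p ((J n ^ k) x - (J (n + 1) ^ (2 * k)) x) ≤ k * ((1 / 4) ^ n * q z) := by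
  obtain ⟨q₁, hq₁, -, hpq₁⟩ := h.apply_le hp
  obtain ⟨q₂, hq₂, hq₂', hpq₂⟩ := h.apply_le hq₁
  obtain ⟨q₃, hq₃, -, hpq₃⟩ := h.apply_le hq₂
  -- The factor `2` dominates the sum `1 + 1/2 + 1/4` of the weights in the second-order remainder.
  refine ⟨(2 : ℝ≥0) • q₃, hq₃.const_smul _, fun x y z hxy hyz n k => ?_⟩
  have step : ∀ x y z, Γ x y → Γ y z →
      q₁ (J n x - (J (n + 1) ^ 2) x) ≤ (1 / 4) ^ n * (2 * q₂ z) := by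
    intro x y z hxy hyz
    have e1 := h.apply_eq n x y hxy
    have e2 := h.apply_eq (n + 1) x y hxy
    have e3 := h.apply_eq n y z hyz
    have e4 := h.apply_eq (n + 1) y z hyz
    -- With `h = 2⁻ⁿ`, both sides expand as `x + h y` plus a remainder: `h² J n z` for one step, `h²
    -- (J (n+1) z / 2 + J (n+1) ^ 2 z / 4)` for two.
    have e5 : J n x - (J (n + 1) ^ 2) x =
        ((2 : ℂ) ^ n)⁻¹ • ((2 : ℂ) ^ n)⁻¹ • (J n z - (1 / 2 : ℂ) • J (n + 1) z -
          (1 / 4 : ℂ) • (J (n + 1) ^ 2) z) := by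
      rw [pow_two (J (n + 1)), Module.End.mul_apply, Module.End.mul_apply, e2, map_add, map_smul,
        e2, e1, e4, map_add, map_smul, e4, e3, pow_succ]
      module
    rw [e5, seminorm_inv_two_pow_smul, seminorm_inv_two_pow_smul, ← mul_assoc, ← mul_pow]
    norm_num only
    gcongr
    refine (map_sub_le_add q₁ _ _).trans ?_
    refine (add_le_add_left (map_sub_le_add q₁ _ _) _).trans ?_
    rw [map_smul_eq_mul, map_smul_eq_mul]
    have h1 := hpq₂ n 1 z
    have h2 := hpq₂ (n + 1) 1 z
    have h3 := hpq₂ (n + 1) 2 z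
    have h4 := apply_nonneg q₂ z
    rw [pow_one] at h1 h2
    norm_num
    linarith
  rw [pow_mul]
  refine seminorm_pow_sub_pow_le p (J n) (J (n + 1) ^ 2) x (fun i j => ?_) k
  rw [← pow_mul]
  refine (hpq₁ n i _).trans ((step _ _ _ (h.graph_pow hxy _ _) (h.graph_pow hyz _ _)).trans ?_)
  gcongr
  change (2 : ℝ) * _ ≤ (2 : ℝ) * _
  gcongr
  exact hpq₃ _ _ _

variable [IsUniformAddGroup X] [PolynormableSpace ℂ X]

theorem exists_graph_sub_lt (h : IsResolventSequence Γ J) {p : Seminorm ℂ X} (hp : Continuous p)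
    (x : X) {ε : ℝ} (hε : 0 < ε) : ∃ x' y, Γ x' y ∧ p (x - x') < ε := by
  obtain ⟨x', ⟨y, hy⟩, hlt⟩ := mem_closure_iff_forall_seminorm.1 (h.dense x) p hp ε hε
  exact ⟨x', y, hy, by rwa [map_sub_rev]⟩

/-- Continuity of the discrete orbits at time zero, uniform in the mesh: `k` steps of length `2⁻ⁿ`
take time at most `δ`. It is Lipschitz on the domain and extends by density and equicontinuity. -/
theorem exists_pow_sub_self_le (h : IsResolventSequence Γ J) {p : Seminorm ℂ X}
    (hp : Continuous p) (x : X) {ε : ℝ} (hε : 0 < ε) :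
    ∃ δ > 0, ∀ n k : ℕ, k ≤ δ * (2 : ℝ) ^ n → p ((J n ^ k) x - x) ≤ ε := by
  obtain ⟨q, hq, hle, hpq⟩ := h.apply_le hp
  obtain ⟨q', hq', hpq'⟩ := h.pow_sub_self_le hp
  obtain ⟨x', y, hxy, hlt⟩ := h.exists_graph_sub_lt hq x (ε := ε / 3) (by positivity)
  have hy := apply_nonneg q' y
  refine ⟨ε / 3 / (q' y + 1), by positivity, fun n k hk => ?_⟩
  have h1 := hpq n k (x - x')
  have h2 := hle (x - x')
  have h3 : p ((J n ^ k) x' - x') ≤ ε / 3 := by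
    refine (hpq' x' y hxy n k).trans ?_
    calc k * ((1 / 2) ^ n * q' y) ≤ (ε / 3 / (q' y + 1) * 2 ^ n) * ((1 / 2) ^ n * q' y) := by gcongr
      _ = ε / 3 * (q' y / (q' y + 1)) * (2 * (1 / 2)) ^ n := by rw [mul_pow]; ring
      _ ≤ ε / 3 * 1 * (2 * (1 / 2)) ^ n := by
          gcongr
          rw [div_le_one (by positivity)]
          linarith
      _ = ε / 3 := by norm_num
  have h4 : (J n ^ k) x - x = (J n ^ k) (x - x') + ((J n ^ k) x' - x') - (x - x') := by
    rw [map_sub]; abel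
  rw [h4]
  have h5 := map_sub_le_add p ((J n ^ k) (x - x') + ((J n ^ k) x' - x')) (x - x')
  have h6 := map_add_le_add p ((J n ^ k) (x - x')) ((J n ^ k) x' - x')
  linarith

/-- The domain of the square is dense, since `J n` maps the domain into it and tends to the
identity. -/
theorem exists_graph_graph_sub_lt (h : IsResolventSequence Γ J) {p : Seminorm ℂ X}
    (hp : Continuous p) (x : X) {ε : ℝ} (hε : 0 < ε) :
    ∃ x' y z, Γ x' y ∧ Γ y z ∧ p (x - x') < ε := by
  obtain ⟨x', y, hxy, hlt⟩ := h.exists_graph_sub_lt hp x (half_pos hε)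
  obtain ⟨δ, hδ, hle⟩ := h.exists_pow_sub_self_le hp x' (ε := ε / 3) (by positivity)
  obtain ⟨n, hn⟩ := pow_unbounded_of_one_lt (1 / δ) (one_lt_two (α := ℝ))
  refine ⟨J n x', J n y, _, h.graph_apply hxy n, h.graph n y, ?_⟩
  have h1 := hle n 1 (by
    rw [div_lt_iff₀ hδ] at hn
    push_cast
    linarith)
  have h2 := map_add_le_add p (x - x') (x' - J n x')
  rw [sub_add_sub_cancel] at h2
  rw [pow_one, map_sub_rev] at h1
  linarith

theorem cauchySeq_pow_floor (h : IsResolventSequence Γ J) (t : ℝ≥0) (x : X) :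
    CauchySeq fun n => (J n ^ ⌊(t : ℝ) * 2 ^ n⌋₊) x := by
  have smooth : ∀ x y z, Γ x y → Γ y z → CauchySeq fun n => (J n ^ ⌊(t : ℝ) * 2 ^ n⌋₊) x := by
    intro x y z hxy hyz
    refine cauchySeq_of_seminorm_le_geometric fun p hp => ?_
    obtain ⟨q, hq, hpq⟩ := h.pow_sub_pow_succ_le hp
    obtain ⟨q₀, hq₀, -, hpq₀⟩ := h.apply_le hp
    obtain ⟨q', hq', hpq'⟩ := h.pow_sub_self_le hq₀
    refine ⟨t * q z + q' y, fun n => ?_⟩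
    set k := ⌊(t : ℝ) * 2 ^ n⌋₊ with hk
    have hk1 : (k : ℝ) ≤ t * 2 ^ n := Nat.floor_le (by positivity)
    have hk2 : (t : ℝ) * 2 ^ n < k + 1 := Nat.lt_floor_add_one _
    -- Halving the mesh doubles the number of steps up to one extra step, whose cost is again
    -- `O(2⁻ⁿ)`.
    obtain ⟨m, hm, hm1⟩ : ∃ m, ⌊(t : ℝ) * 2 ^ (n + 1)⌋₊ = 2 * k + m ∧ m ≤ 1 := by
      have ha : 2 * k ≤ ⌊(t : ℝ) * 2 ^ (n + 1)⌋₊ := Nat.le_floor (by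
        push_cast; rw [pow_succ]; linarith)
      have hb : ⌊(t : ℝ) * 2 ^ (n + 1)⌋₊ < 2 * k + 2 := (Nat.floor_lt (by positivity)).2 (by
        push_cast; rw [pow_succ]; linarith)
      exact ⟨_, (Nat.add_sub_of_le ha).symm, by omega⟩
    have h1 := hpq x y z hxy hyz n k
    have h2 := (hpq₀ (n + 1) (2 * k) _).trans (hpq' x y hxy (n + 1) m)
    rw [map_sub, ← Module.End.mul_apply, ← pow_add] at h2
    rw [hm]
    rw [map_sub_rev] at h1
    have h3 := map_add_le_add p ((J (n + 1) ^ (2 * k + m)) x - (J (n + 1) ^ (2 * k)) x)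
      ((J (n + 1) ^ (2 * k)) x - (J n ^ k) x)
    rw [sub_add_sub_cancel] at h3
    have h4 : (k : ℝ) * ((1 / 4) ^ n * q z) ≤ t * q z * (1 / 2) ^ n := by
      have hz := apply_nonneg q z
      calc (k : ℝ) * ((1 / 4) ^ n * q z) ≤ (t * 2 ^ n) * ((1 / 4) ^ n * q z) := by gcongr
        _ = t * q z * (2 * (1 / 4)) ^ n := by rw [mul_pow]; ring
        _ = _ := by norm_num
    have h5 : (m : ℝ) * ((1 / 2) ^ (n + 1) * q' y) ≤ q' y * (1 / 2) ^ n := by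
      have hy := apply_nonneg q' y
      have hm1' : (m : ℝ) ≤ 1 := by exact_mod_cast hm1
      have : (0 : ℝ) < (1 / 2) ^ n := by positivity
      calc (m : ℝ) * ((1 / 2) ^ (n + 1) * q' y) ≤ 1 * ((1 / 2) ^ (n + 1) * q' y) := by gcongr
        _ ≤ _ := by rw [pow_succ]; nlinarith [mul_nonneg hy this.le]
    linarith
  refine cauchySeq_of_forall_seminorm fun p hp ε hε => ?_
  obtain ⟨q, hq, -, hpq⟩ := h.apply_le hp
  obtain ⟨x', y, z, hxy, hyz, hlt⟩ := h.exists_graph_graph_sub_lt hq x (ε := ε / 3) (by positivity)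
  have hc := smooth x' y z hxy hyz
  rw [cauchySeq_iff_tendsto, uniformity_eq_comap_nhds_zero, tendsto_comap_iff,
    tendsto_iff_forall_seminorm] at hc
  obtain ⟨⟨N, N'⟩, hN⟩ := eventually_atTop.1 (hc p hp (ε / 3) (by positivity))
  refine ⟨max N N', fun n hn m hm => ?_⟩
  have h0 := hN (n, m) ⟨le_of_max_le_left hn, le_of_max_le_right hm⟩
  simp only [Function.comp_apply, Prod.map_fst, Prod.map_snd, sub_zero] at h0
  set a := ⌊(t : ℝ) * 2 ^ n⌋₊
  set b := ⌊(t : ℝ) * 2 ^ m⌋₊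
  have h1 := hpq n a (x - x')
  have h2 := hpq m b (x - x')
  have h3 : (J m ^ b) x - (J n ^ a) x = ((J m ^ b) x' - (J n ^ a) x') + (J m ^ b) (x - x') -
      (J n ^ a) (x - x') := by
    rw [map_sub, map_sub]; abel
  rw [h3]
  have h5 := map_sub_le_add p ((J m ^ b) x' - (J n ^ a) x' + (J m ^ b) (x - x'))
    ((J n ^ a) (x - x'))
  have h6 := map_add_le_add p ((J m ^ b) x' - (J n ^ a) x') ((J m ^ b) (x - x'))
  linarith

end IsResolventSequence

end BackwardEuler

/-! ### The limit semigroup and its derivative at zero -/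

section LimitSemigroup

variable {X : Type*} [AddCommGroup X] [Module ℂ X] [UniformSpace X] [IsUniformAddGroup X]
  [ContinuousSMul ℂ X] [PolynormableSpace ℂ X]

variable {Γ : X → X → Prop} {J : ℕ → Module.End ℂ X}

namespace IsResolventSequence

theorem exists_limit [T2Space X] (h : IsResolventSequence Γ J)
    (hX : ∀ u : ℕ → X, CauchySeq u → ∃ x, Tendsto u atTop (𝓝 x)) (t : ℝ≥0) :
    ∃ L : X →L[ℂ] X, ∀ x, Tendsto (fun n => (J n ^ ⌊(t : ℝ) * 2 ^ n⌋₊) x) atTop (𝓝 (L x)) := by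
  choose f hf using fun x => hX _ (h.cauchySeq_pow_floor t x)
  let L : X →ₗ[ℂ] X :=
    { toFun := f
      map_add' := fun x y => tendsto_nhds_unique (hf (x + y)) (by
        simpa only [map_add] using (hf x).add (hf y))
      map_smul' := fun c x => tendsto_nhds_unique (hf (c • x)) (by
        simp only [map_smul, RingHom.id_apply]
        exact (hf x).const_smul c) }
  refine ⟨⟨L, continuous_of_forall_seminorm L fun p hp => ?_⟩, hf⟩
  obtain ⟨q, hq, hpq⟩ := h.equicontinuous p hp
  exact ⟨q, hq, fun x => seminorm_le_of_tendsto hp (hf x) tendsto_const_nhds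
    (Eventually.of_forall fun n => hpq n _ x)⟩

variable {S : ℝ≥0 → X →L[ℂ] X}

omit [ContinuousSMul ℂ X] in
theorem limit_sub_le (h : IsResolventSequence Γ J)
    (hS : ∀ (t : ℝ≥0) x, Tendsto (fun n => (J n ^ ⌊(t : ℝ) * 2 ^ n⌋₊) x) atTop (𝓝 (S t x)))
    {p : Seminorm ℂ X} (hp : Continuous p) (x : X) {ε : ℝ} (hε : 0 < ε) :
    ∃ δ > 0, ∀ s t : ℝ≥0, s ≤ t → (t : ℝ) ≤ s + δ → p (S t x - S s x) ≤ ε := by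
  obtain ⟨q, hq, -, hpq⟩ := h.apply_le hp
  obtain ⟨δ, hδ, hle⟩ := h.exists_pow_sub_self_le hq x hε
  -- The other half of `δ` absorbs the rounding of less than one step once `2 / δ ≤ 2ⁿ`.
  refine ⟨δ / 2, by positivity, fun s t hst hts => ?_⟩
  refine seminorm_le_of_tendsto hp ((hS t x).sub (hS s x)) tendsto_const_nhds ?_
  have hev : ∀ᶠ n : ℕ in atTop, 2 / δ ≤ (2 : ℝ) ^ n :=
    (tendsto_pow_atTop_atTop_of_one_lt one_lt_two).eventually_ge_atTop _
  filter_upwards [hev] with n hn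
  have hst' : (s : ℝ) ≤ t := hst
  obtain ⟨m, hm⟩ := Nat.exists_eq_add_of_le
    (Nat.floor_mono (show (s : ℝ) * 2 ^ n ≤ t * 2 ^ n by gcongr))
  have h1 : (⌊(t : ℝ) * 2 ^ n⌋₊ : ℝ) ≤ t * 2 ^ n := Nat.floor_le (by positivity)
  have h2 := Nat.lt_floor_add_one ((s : ℝ) * 2 ^ n)
  rw [hm] at h1 ⊢
  rw [pow_add, Module.End.mul_apply, ← map_sub]
  refine (hpq n _ _).trans (hle n m ?_)
  push_cast at h1
  rw [div_le_iff₀ hδ] at hn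
  have h3 : (t : ℝ) * 2 ^ n ≤ (s + δ / 2) * 2 ^ n := by gcongr
  linarith

omit [IsUniformAddGroup X] [ContinuousSMul ℂ X] [PolynormableSpace ℂ X] in
theorem limit_zero [T2Space X]
    (hS : ∀ (t : ℝ≥0) x, Tendsto (fun n => (J n ^ ⌊(t : ℝ) * 2 ^ n⌋₊) x) atTop (𝓝 (S t x))) (x : X) :
    S 0 x = x :=
  tendsto_nhds_unique (hS 0 x) (by simp)

omit [ContinuousSMul ℂ X] in
theorem limit_add [T2Space X] (h : IsResolventSequence Γ J)
    (hS : ∀ (t : ℝ≥0) x, Tendsto (fun n => (J n ^ ⌊(t : ℝ) * 2 ^ n⌋₊) x) atTop (𝓝 (S t x)))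
    (s t : ℝ≥0) (x : X) : S (s + t) x = S s (S t x) := by
  refine tendsto_nhds_unique (hS (s + t) x) ?_
  have key : Tendsto (fun n => (J n ^ ⌊((s + t : ℝ≥0) : ℝ) * 2 ^ n⌋₊) x -
      (J n ^ ⌊(s : ℝ) * 2 ^ n⌋₊) (S t x)) atTop (𝓝 0) := by
    rw [tendsto_iff_forall_seminorm]
    intro p hp ε hε
    obtain ⟨q, hq, -, hpq⟩ := h.apply_le hp
    obtain ⟨q', hq', -, hpq'⟩ := h.apply_le hq
    obtain ⟨δ, hδ, hle⟩ := h.exists_pow_sub_self_le hq' x (ε := ε / 3) (by positivity)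
    have hev : ∀ᶠ n : ℕ in atTop, 1 / δ ≤ (2 : ℝ) ^ n :=
      (tendsto_pow_atTop_atTop_of_one_lt one_lt_two).eventually_ge_atTop _
    filter_upwards [hev, tendsto_iff_forall_seminorm.1 (hS t x) q hq (ε / 3) (by positivity)]
      with n hn hlim
    rw [sub_zero]
    have hs := Nat.floor_le (show (0 : ℝ) ≤ s * 2 ^ n by positivity)
    have hs' := Nat.lt_floor_add_one ((s : ℝ) * 2 ^ n)
    have ht := Nat.floor_le (show (0 : ℝ) ≤ t * 2 ^ n by positivity)
    have ht' := Nat.lt_floor_add_one ((t : ℝ) * 2 ^ n)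
    set a := ⌊(s : ℝ) * 2 ^ n⌋₊
    set b := ⌊(t : ℝ) * 2 ^ n⌋₊
    -- The floor is additive up to one step, and one step is negligible in the limit.
    obtain ⟨m, hm, hm1⟩ : ∃ m, ⌊((s + t : ℝ≥0) : ℝ) * 2 ^ n⌋₊ = a + b + m ∧ m ≤ 1 := by
      have ha : a + b ≤ ⌊((s + t : ℝ≥0) : ℝ) * 2 ^ n⌋₊ := Nat.le_floor (by
        push_cast; rw [add_mul]; linarith)
      have hb : ⌊((s + t : ℝ≥0) : ℝ) * 2 ^ n⌋₊ < a + b + 2 :=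
        (Nat.floor_lt (by positivity)).2 (by push_cast; rw [add_mul]; linarith)
      exact ⟨_, (Nat.add_sub_of_le ha).symm, by omega⟩
    have hm1' : (m : ℝ) ≤ 1 := by exact_mod_cast hm1
    have h1 : (J n ^ ⌊((s + t : ℝ≥0) : ℝ) * 2 ^ n⌋₊) x - (J n ^ a) (S t x) =
        (J n ^ a) ((J n ^ b) ((J n ^ m) x - x)) + (J n ^ a) ((J n ^ b) x - S t x) := by
      rw [hm, pow_add, pow_add]
      simp
    rw [h1]
    have h2 := (hpq n a _).trans ((hpq' n b _).trans (hle n m (by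
      rw [div_le_iff₀ hδ] at hn; linarith)))
    have h3 := hpq n a ((J n ^ b) x - S t x)
    have h4 := map_add_le_add p ((J n ^ a) ((J n ^ b) ((J n ^ m) x - x)))
      ((J n ^ a) ((J n ^ b) x - S t x))
    linarith
  simpa using key.add (hS s (S t x))

omit [ContinuousSMul ℂ X] in
theorem isStronglyContinuousSemigroup_limit [T2Space X] (h : IsResolventSequence Γ J)
    (hS : ∀ (t : ℝ≥0) x, Tendsto (fun n => (J n ^ ⌊(t : ℝ) * 2 ^ n⌋₊) x) atTop (𝓝 (S t x))) :
    IsStronglyContinuousSemigroup S where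
  map_zero := by ext x; exact limit_zero hS x
  map_add s t := by ext x; exact h.limit_add hS s t x
  continuous_orbit x := by
    refine continuous_iff_continuousAt.2 fun t => tendsto_iff_forall_seminorm.2 fun p hp ε hε => ?_
    obtain ⟨δ, hδ, hle⟩ := h.limit_sub_le hS hp x (half_pos hε)
    filter_upwards [Metric.ball_mem_nhds t hδ] with s hs
    rw [Metric.mem_ball, NNReal.dist_eq, abs_lt] at hs
    rcases le_total s t with hst | hst
    · rw [map_sub_rev]
      linarith [hle s t hst (by linarith)]
    · linarith [hle t s hst (by linarith)]

theorem tendsto_limit_slope_zero [T2Space X] (h : IsResolventSequence Γ J)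
    (hS : ∀ (t : ℝ≥0) x, Tendsto (fun n => (J n ^ ⌊(t : ℝ) * 2 ^ n⌋₊) x) atTop (𝓝 (S t x)))
    {x y : X} (hxy : Γ x y) :
    Tendsto (fun t : ℝ≥0 => (((t : ℝ) : ℂ)⁻¹) • (S t x - x)) (𝓝[>] 0) (𝓝 y) := by
  refine tendsto_iff_forall_seminorm.2 fun p hp ε hε => ?_
  obtain ⟨δ, hδ, hle⟩ := h.exists_pow_sub_self_le hp y (half_pos hε)
  have hmem : Set.Iio (⟨δ, hδ.le⟩ : ℝ≥0) ∈ 𝓝[>] (0 : ℝ≥0) :=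
    nhdsWithin_le_nhds (Iio_mem_nhds hδ)
  filter_upwards [hmem, self_mem_nhdsWithin] with t ht ht0
  have ht' : (t : ℝ) < δ := ht
  have ht0' : 0 < (t : ℝ) := ht0
  -- Discrete form of `S(t)x - x - t y = ∫₀^t (S(s)y - y) ds`: each Euler step adds `2⁻ⁿ` times an
  -- increment of the orbit of `y`.
  have step : ∀ n k : ℕ, k ≤ δ * (2 : ℝ) ^ n →
      p ((J n ^ k) x - x - (k : ℂ) • ((2 : ℂ) ^ n)⁻¹ • y) ≤ k * (1 / 2) ^ n * (ε / 2) := by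
    intro n k
    induction k with
    | zero => simp
    | succ k ih =>
      intro hk
      have h1 : (J n ^ (k + 1)) x - x - ((k + 1 : ℕ) : ℂ) • ((2 : ℂ) ^ n)⁻¹ • y =
          ((J n ^ k) x - x - (k : ℂ) • ((2 : ℂ) ^ n)⁻¹ • y) +
          ((2 : ℂ) ^ n)⁻¹ • ((J n ^ (k + 1)) y - y) := by
        rw [pow_succ, Module.End.mul_apply, h.apply_eq n x y hxy, map_add, map_smul,
          Module.End.mul_apply]
        push_cast
        module
      rw [h1]
      refine (map_add_le_add p _ _).trans ?_
      rw [seminorm_inv_two_pow_smul]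
      have h2 := hle n (k + 1) hk
      push_cast at hk ⊢
      have h3 := ih (by linarith)
      have h4 : (1 / 2 : ℝ) ^ n * p ((J n ^ (k + 1)) y - y) ≤ (1 / 2) ^ n * (ε / 2) := by gcongr
      linarith
  have hpow : Tendsto (fun n : ℕ => (2 : ℝ) ^ n) atTop atTop :=
    tendsto_pow_atTop_atTop_of_one_lt one_lt_two
  have hk : Tendsto (fun n : ℕ => (⌊(t : ℝ) * 2 ^ n⌋₊ : ℝ) / 2 ^ n) atTop (𝓝 (t : ℝ)) :=
    (tendsto_nat_floor_mul_div_atTop t.2).comp hpow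
  have hk' : Tendsto (fun n : ℕ => (⌊(t : ℝ) * 2 ^ n⌋₊ : ℂ) • ((2 : ℂ) ^ n)⁻¹ • y) atTop
      (𝓝 (((t : ℝ) : ℂ) • y)) := by
    have := ((Complex.continuous_ofReal.tendsto _).comp hk).smul_const y
    refine this.congr fun n => ?_
    simp [smul_smul, div_eq_mul_inv]
  have main : p (S t x - x - ((t : ℝ) : ℂ) • y) ≤ t * (ε / 2) := by
    refine seminorm_le_of_tendsto hp (((hS t x).sub_const x).sub hk') (hk.mul_const (ε / 2))
      (Eventually.of_forall fun n => ?_)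
    have h1 : (⌊(t : ℝ) * 2 ^ n⌋₊ : ℝ) ≤ δ * 2 ^ n :=
      (Nat.floor_le (by positivity)).trans (by gcongr)
    refine (step n _ h1).trans (le_of_eq ?_)
    rw [one_div, inv_pow]
    rfl
  have hne : ((t : ℝ) : ℂ) ≠ 0 := by exact_mod_cast ht0'.ne'
  have h2 : (((t : ℝ) : ℂ)⁻¹) • (S t x - x) - y =
      (((t : ℝ) : ℂ)⁻¹) • (S t x - x - ((t : ℝ) : ℂ) • y) := by
    rw [smul_sub _ (S t x - x), inv_smul_smul₀ hne]
  rw [h2, map_smul_eq_mul, norm_inv, Complex.norm_real, Real.norm_of_nonneg ht0'.le,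
    inv_mul_lt_iff₀ ht0']
  refine main.trans_lt ?_
  gcongr
  linarith

end IsResolventSequence

end LimitSemigroup

/-! ### Multiplying a semigroup by an exponential -/

section Rescaling

theorem tendsto_coe_nhdsGT_zero :
    Tendsto (fun t : ℝ≥0 => (t : ℝ)) (𝓝[>] 0) (𝓝[>] (0 : ℝ)) :=
  tendsto_nhdsWithin_iff.2 ⟨(NNReal.continuous_coe.tendsto 0).mono_left nhdsWithin_le_nhds,
    eventually_mem_nhdsWithin.mono fun _ ht => NNReal.coe_pos.2 ht⟩

theorem tendsto_inv_mul_exp_sub_one (z : ℂ) :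
    Tendsto (fun t : ℝ≥0 => ((t : ℝ) : ℂ)⁻¹ * (Complex.exp (z * (t : ℝ)) - 1)) (𝓝[>] 0)
      (𝓝 z) := by
  have h : HasDerivAt (fun t : ℝ => Complex.exp (z * t)) z 0 := by
    simpa using ((Complex.ofRealCLM.hasDerivAt (x := 0)).const_mul z).cexp
  have := h.tendsto_slope_zero_right.comp tendsto_coe_nhdsGT_zero
  simpa [Function.comp_def] using this

theorem tendsto_inv_mul_real_exp_sub_one (a : ℝ) :
    Tendsto (fun t : ℝ≥0 => (t : ℝ)⁻¹ * (Real.exp (a * t) - 1)) (𝓝[>] 0) (𝓝 a) := by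
  have h : HasDerivAt (fun t : ℝ => Real.exp (a * t)) a 0 := by
    simpa using ((hasDerivAt_id (0 : ℝ)).const_mul a).exp
  have := h.tendsto_slope_zero_right.comp tendsto_coe_nhdsGT_zero
  simpa [Function.comp_def] using this

variable {X : Type*} [AddCommGroup X] [Module ℂ X] [UniformSpace X] [ContinuousSMul ℂ X]

/-- The semigroup `e^{zt} T(t)`. -/
noncomputable def rescale (z : ℂ) (T : ℝ≥0 → X →L[ℂ] X) (t : ℝ≥0) : X →L[ℂ] X :=
  Complex.exp (z * (t : ℝ)) • T t

variable {T : ℝ≥0 → X →L[ℂ] X}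

theorem rescale_apply (z : ℂ) (t : ℝ≥0) (x : X) :
    rescale z T t x = Complex.exp (z * (t : ℝ)) • T t x := rfl

theorem IsStronglyContinuousSemigroup.rescale (hT : IsStronglyContinuousSemigroup T) (z : ℂ) :
    IsStronglyContinuousSemigroup (rescale z T) where
  map_zero := by ext x; simp [rescale_apply, hT.map_zero]
  map_add s t := by
    ext x
    rw [rescale_apply, hT.map_add]
    simp [rescale_apply, smul_smul, mul_add, Complex.exp_add, mul_comm]
  continuous_orbit x := by
    have : Continuous fun t : ℝ≥0 => Complex.exp (z * (t : ℝ)) := by fun_prop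
    exact this.smul (hT.continuous_orbit x)

theorem seminorm_rescale (p : Seminorm ℂ X) (z : ℂ) (t : ℝ≥0) (x : X) :
    p (rescale z T t x) = Real.exp (z.re * t) * p (T t x) := by
  rw [rescale_apply, map_smul_eq_mul, Complex.norm_exp]
  simp

theorem rescale_neg_rescale (z : ℂ) : rescale z (rescale (-z) T) = T := by
  ext t x
  simp [rescale_apply, smul_smul, ← Complex.exp_add]

variable [IsUniformAddGroup X]

theorem tendsto_rescale (z : ℂ) {x y : X}
    (h : Tendsto (fun t : ℝ≥0 => (((t : ℝ) : ℂ)⁻¹) • (T t x - x)) (𝓝[>] 0) (𝓝 y)) :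
    Tendsto (fun t : ℝ≥0 => (((t : ℝ) : ℂ)⁻¹) • (rescale z T t x - x)) (𝓝[>] 0)
      (𝓝 (y + z • x)) := by
  have h1 : Tendsto (fun t : ℝ≥0 => Complex.exp (z * (t : ℝ))) (𝓝[>] 0) (𝓝 1) := by
    have : Continuous fun t : ℝ≥0 => Complex.exp (z * (t : ℝ)) := by fun_prop
    simpa using (this.tendsto 0).mono_left nhdsWithin_le_nhds
  have h2 := (h1.smul h).add ((tendsto_inv_mul_exp_sub_one z).smul_const x)
  rw [one_smul] at h2
  refine h2.congr fun t => ?_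
  rw [rescale_apply]
  module

end Rescaling

/-! ### Dissipativity, and inverting the generator of a decaying semigroup -/

section Decay

variable {X : Type*} [AddCommGroup X] [Module ℂ X] [UniformSpace X]

/-- Renorming by `r x = sup_t e^{-ωt} p(T(t)x)`; the semigroup law shifts `t` inside the supremum.
The clause with `c` records that it is the least upper bound. -/
theorem exists_contractive_seminorm [IsUniformAddGroup X] {T : ℝ≥0 → X →L[ℂ] X}
    (hT : IsStronglyContinuousSemigroup T) {ω : ℝ} {p q : Seminorm ℂ X} (hq : Continuous q)
    (hpq : ∀ (x : X) (t : ℝ≥0), Real.exp (-ω * t) * p (T t x) ≤ q x) :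
    ∃ r : Seminorm ℂ X, Continuous r ∧ (∀ x, p x ≤ r x) ∧ (∀ x, r x ≤ q x) ∧
      (∀ x c, (∀ t : ℝ≥0, Real.exp (-ω * t) * p (T t x) ≤ c) → r x ≤ c) ∧
      ∀ (t : ℝ≥0) x, r (T t x) ≤ Real.exp (ω * t) * r x := by
  obtain ⟨e, he⟩ : ∃ e : ℝ≥0 → ℝ≥0, ∀ t, (e t : ℝ) = Real.exp (-ω * t) :=
    ⟨fun t => ⟨Real.exp (-ω * t), (Real.exp_pos _).le⟩, fun _ => rfl⟩
  have hP : ∀ t x, (e t • p.comp (T t : X →ₗ[ℂ] X)) x = Real.exp (-ω * t) * p (T t x) :=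
    fun t x => by rw [← he]; rfl
  obtain ⟨r, hr, hPr', hrc⟩ := exists_iSup_seminorm (fun t => e t • p.comp (T t : X →ₗ[ℂ] X)) hq
    fun t x => (hP t x).trans_le (hpq x t)
  simp only [hP] at hPr' hrc
  refine ⟨r, hr, fun x => ?_, fun x => hrc x _ fun t => hpq x t, hrc, fun s x => hrc _ _ fun t => ?_⟩
  · simpa [hT.map_zero] using hPr' 0 x
  · have h1 := hPr' (t + s) x
    rw [hT.map_add, ContinuousLinearMap.comp_apply] at h1
    calc Real.exp (-ω * t) * p (T t (T s x))
        = Real.exp (ω * s) * (Real.exp (-ω * (t + s : ℝ≥0)) * p (T t (T s x))) := by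
          rw [← mul_assoc, ← Real.exp_add]
          congr 2
          push_cast
          ring
      _ ≤ _ := by gcongr

/-- The quotient `l x - (T(t)x - x)/t` equals `((1 + l t)x - T(t)x)/t`; the reverse triangle
inequality and `‖1 + l t‖ ≥ 1 + t Re l` bound it below before `t ↓ 0`. -/
theorem dissipative_of_contractive {T : ℝ≥0 → X →L[ℂ] X} [IsUniformAddGroup X]
    {ω : ℝ} {r : Seminorm ℂ X} (hr : Continuous r)
    (hrT : ∀ (t : ℝ≥0) x, r (T t x) ≤ Real.exp (ω * t) * r x) {x y : X}
    (h : Tendsto (fun t : ℝ≥0 => (((t : ℝ) : ℂ)⁻¹) • (T t x - x)) (𝓝[>] 0) (𝓝 y)) (l : ℂ) :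
    (l.re - ω) * r x ≤ r (l • x - y) := by
  have h1 := (hr.tendsto _).comp (h.const_sub (l • x))
  have h2 := ((tendsto_inv_mul_real_exp_sub_one ω).const_sub l.re).mul_const (r x)
  refine le_of_tendsto_of_tendsto h2 h1 ?_
  filter_upwards [self_mem_nhdsWithin] with t ht
  have ht' : 0 < (t : ℝ) := ht
  have hne : ((t : ℝ) : ℂ) ≠ 0 := by exact_mod_cast ht'.ne'
  have h3 : l • x - ((t : ℝ) : ℂ)⁻¹ • (T t x - x) =
      ((t : ℝ) : ℂ)⁻¹ • ((1 + l * (t : ℝ)) • x - T t x) := by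
    rw [smul_sub, smul_sub, smul_smul, mul_add, mul_one, mul_comm l, inv_mul_cancel_left₀ hne]
    module
  simp only [Function.comp_apply]
  rw [h3, map_smul_eq_mul, norm_inv, Complex.norm_real, Real.norm_of_nonneg ht'.le,
    le_inv_mul_iff₀ ht']
  have h4 := (le_abs_self _).trans (Seminorm.norm_sub_map_le_sub r ((1 + l * (t : ℝ)) • x) (T t x))
  have h5 : 1 + l.re * t ≤ ‖1 + l * (t : ℝ)‖ := by
    simpa using Complex.re_le_norm (1 + l * (t : ℝ))
  have h6 := mul_le_mul_of_nonneg_right h5 (apply_nonneg r x)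
  have h7 := hrT t x
  rw [map_smul_eq_mul] at h4
  have h8 : (t : ℝ) * ((l.re - (t : ℝ)⁻¹ * (Real.exp (ω * t) - 1)) * r x) =
      (1 + l.re * t) * r x - Real.exp (ω * t) * r x := by
    field_simp
    ring
  linarith

/-- Splitting the sum over `N + m` terms in two ways. It is the discrete form of `(1 - S(b)) ∫₀^a S
= (1 - S(a)) ∫₀^b S`. -/
theorem sum_sub_apply_sum {S : ℝ≥0 → X →L[ℂ] X} (hS : IsStronglyContinuousSemigroup S) (h : ℝ≥0)
    (x : X) (N m : ℕ) :
    ∑ k ∈ Finset.range N, S (k * h) x - S (m * h) (∑ k ∈ Finset.range N, S (k * h) x) =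
    ∑ k ∈ Finset.range m, S (k * h) x - S (N * h) (∑ k ∈ Finset.range m, S (k * h) x) := by
  have key : ∀ N m : ℕ, ∑ k ∈ Finset.range (N + m), S (k * h) x =
      ∑ k ∈ Finset.range N, S (k * h) x + S (N * h) (∑ k ∈ Finset.range m, S (k * h) x) := by
    intro N m
    rw [Finset.sum_range_add, map_sum]
    congr 1
    refine Finset.sum_congr rfl fun k _ => ?_
    rw [← ContinuousLinearMap.comp_apply, ← hS.map_add]
    push_cast
    rw [add_mul]
  have h1 := key N m
  rw [add_comm N m, key m N] at h1
  rw [sub_eq_sub_iff_add_eq_add, h1]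

/-- After exchanging the lengths `N` and `m`, only times up to `m h ≤ δ` remain, where `S` is nearly
the identity, plus a tail killed by the decay at time `N h`. Thus `(1 - S(t)) y ≈ t x` for the
Riemann sum `y`. -/
theorem seminorm_riemannSum_le {S : ℝ≥0 → X →L[ℂ] X} (hS : IsStronglyContinuousSemigroup S)
    {r : Seminorm ℂ X} {ε : ℝ} (hε : 0 < ε)
    (hrS : ∀ (t : ℝ≥0) x, r (S t x) ≤ Real.exp (-ε * t) * r x) {x : X} {η : ℝ} {δ : ℝ≥0}
    (hδ : ∀ s ≤ δ, r (S s x - x) ≤ η) (h : ℝ≥0) (N m : ℕ) (hm : m * h ≤ δ) :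
    r (((h : ℝ) : ℂ) • ∑ k ∈ Finset.range N, S (k * h) x -
      S (m * h) (((h : ℝ) : ℂ) • ∑ k ∈ Finset.range N, S (k * h) x) -
      ((m * h : ℝ) : ℂ) • x) ≤ m * h * (η + Real.exp (-ε * (N * h)) * r x) := by
  have h1 : ((h : ℝ) : ℂ) • ∑ k ∈ Finset.range N, S (k * h) x -
      S (m * h) (((h : ℝ) : ℂ) • ∑ k ∈ Finset.range N, S (k * h) x) - ((m * h : ℝ) : ℂ) • x =
      ((h : ℝ) : ℂ) • ∑ k ∈ Finset.range m, ((S (k * h) x - x) - S (N * h) (S (k * h) x)) := by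
    rw [map_smul, ← smul_sub, sum_sub_apply_sum hS, Finset.sum_sub_distrib, Finset.sum_sub_distrib,
      map_sum, Finset.sum_const, Finset.card_range, ← Nat.cast_smul_eq_nsmul ℂ]
    push_cast
    module
  rw [h1, map_smul_eq_mul, Complex.norm_real, Real.norm_of_nonneg h.coe_nonneg,
    mul_comm (m : ℝ), mul_assoc]
  refine mul_le_mul_of_nonneg_left ?_ h.coe_nonneg
  refine (Finset.le_sum_of_subadditive r (map_zero r).le (map_add_le_add r) _ _).trans ?_
  refine (Finset.sum_le_card_nsmul _ _ (η + Real.exp (-ε * (N * h)) * r x)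
    fun k hk => ?_).trans_eq (by rw [Finset.card_range, nsmul_eq_mul])
  refine (map_sub_le_add r _ _).trans (add_le_add (hδ _ ?_) ?_)
  · refine le_trans ?_ hm
    gcongr
    exact_mod_cast (Finset.mem_range.1 hk).le
  · have h2 := hrS (N * h) (S (k * h) x)
    push_cast at h2
    refine h2.trans (mul_le_mul_of_nonneg_left ?_ (Real.exp_pos _).le)
    refine (hrS _ _).trans ?_
    refine mul_le_of_le_one_left (apply_nonneg _ _) (Real.exp_le_one_iff.2 ?_)
    rw [neg_mul, neg_nonpos]
    positivity

variable [IsUniformAddGroup X] [PolynormableSpace ℂ X] [ContinuousSMul ℂ X]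

omit [IsUniformAddGroup X] [ContinuousSMul ℂ X] in
theorem exists_forall_le_seminorm_sub_le {S : ℝ≥0 → X →L[ℂ] X}
    (hS : IsStronglyContinuousSemigroup S) {r : Seminorm ℂ X} (hr : Continuous r) (x : X) {η : ℝ}
    (hη : 0 < η) : ∃ δ : ℝ≥0, 0 < δ ∧ ∀ s ≤ δ, r (S s x - x) ≤ η := by
  have h := tendsto_iff_forall_seminorm.1 ((hS.continuous_orbit x).tendsto 0) r hr η hη
  obtain ⟨δ, hδ, hball⟩ := Metric.eventually_nhds_iff.1 h
  refine ⟨(δ / 2).toNNReal, Real.toNNReal_pos.2 (by positivity), fun s hs => ?_⟩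
  have hs' := (Real.le_toNNReal_iff_coe_le (by positivity)).1 hs
  have := hball (y := s) (by
    rw [NNReal.dist_eq, NNReal.coe_zero, sub_zero, abs_of_nonneg s.coe_nonneg]; linarith)
  simpa [hS.map_zero] using this.le

omit [ContinuousSMul ℂ X] in
-- Mesh `2⁻ⁿ` and `4ⁿ` terms cover `[0, 2ⁿ)`. For a fixed `h = 2⁻ᴺ`, all later sums nearly solve `y
-- - S(h) y = h x`, and the decay makes `1 - S(h)` bounded below.
theorem cauchySeq_riemannSum {S : ℝ≥0 → X →L[ℂ] X} (hS : IsStronglyContinuousSemigroup S) {ε : ℝ}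
    (hε : 0 < ε)
    (hdecay : ∀ p : Seminorm ℂ X, Continuous p → ∃ r : Seminorm ℂ X, Continuous r ∧
      (∀ x, p x ≤ r x) ∧ ∀ (t : ℝ≥0) x, r (S t x) ≤ Real.exp (-ε * t) * r x) (x : X) :
    CauchySeq fun n : ℕ => ((((1 / 2) ^ n : ℝ≥0) : ℝ) : ℂ) •
      ∑ k ∈ Finset.range (4 ^ n), S (k * (1 / 2) ^ n) x := by
  refine cauchySeq_of_forall_seminorm fun p hp η hη => ?_
  obtain ⟨r, hr, hpr, hrS⟩ := hdecay p hp
  -- `(1 + ε)/ε` comes from `1 - e^{-εh} ≥ εh/(1 + ε)` for `h ≤ 1`; the `2` counts the errors of the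
  -- two sums compared.
  set C := 2 * ((1 + ε) / ε) with hC
  have hC0 : 0 < C := by positivity
  obtain ⟨δ, hδ, hle⟩ := exists_forall_le_seminorm_sub_le hS hr x (η := η / (4 * C)) (by positivity)
  have hpow : Tendsto (fun n : ℕ => (2 : ℝ) ^ n) atTop atTop :=
    tendsto_pow_atTop_atTop_of_one_lt one_lt_two
  have hexp : Tendsto (fun n : ℕ => Real.exp (-ε * 2 ^ n) * r x) atTop (𝓝 (0 * r x)) :=
    (Real.tendsto_exp_atBot.comp
      (hpow.const_mul_atTop_of_neg (neg_lt_zero.2 hε))).mul_const _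
  rw [zero_mul] at hexp
  have hhalf : Tendsto (fun n : ℕ => (1 / 2 : ℝ≥0) ^ n) atTop (𝓝 0) :=
    tendsto_pow_atTop_nhds_zero_of_lt_one (by simp) (by norm_num)
  obtain ⟨N, hN1, hN2⟩ := ((hexp.eventually (gt_mem_nhds (show (0 : ℝ) < η / (8 * C) by
    positivity))).and (hhalf.eventually (ge_mem_nhds hδ))).exists
  set y : ℕ → X := fun n : ℕ => ((((1 / 2) ^ n : ℝ≥0) : ℝ) : ℂ) •
      ∑ k ∈ Finset.range (4 ^ n), S (k * (1 / 2) ^ n) x with hy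
  set h : ℝ≥0 := (1 / 2) ^ N with hh
  have hh0 : 0 < (h : ℝ) := by rw [hh]; positivity
  have hh1 : (h : ℝ) ≤ 1 := by
    rw [hh]
    push_cast
    exact pow_le_one₀ (by positivity) (by norm_num)
  have step : ∀ n ≥ N, r (y n - S h (y n) - (((h : ℝ)) : ℂ) • x) ≤
      h * (η / (4 * C) + Real.exp (-ε * 2 ^ N) * r x) := by
    intro n hn
    obtain ⟨j, rfl⟩ := Nat.exists_eq_add_of_le hn
    have e1 : ((2 ^ j : ℕ) : ℝ≥0) * (1 / 2) ^ (N + j) = h := by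
      rw [hh, pow_add, mul_left_comm]
      push_cast
      rw [← mul_pow]
      norm_num
    have h1 := seminorm_riemannSum_le hS hε hrS hle ((1 / 2) ^ (N + j)) (4 ^ (N + j)) (2 ^ j)
      (by rw [e1]; exact hN2)
    have e2 : ((2 ^ j : ℕ) : ℝ) * (((1 / 2) ^ (N + j) : ℝ≥0) : ℝ) = h := by
      rw [← e1]; push_cast; rfl
    have e3 : ((4 ^ (N + j) : ℕ) : ℝ) * (((1 / 2) ^ (N + j) : ℝ≥0) : ℝ) = 2 ^ (N + j) := by
      push_cast
      rw [← mul_pow]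
      norm_num
    rw [e1, e2, e3] at h1
    refine h1.trans ?_
    gcongr ?_ * (_ + Real.exp ?_ * _)
    rw [neg_mul, neg_mul, neg_le_neg_iff]
    gcongr
    norm_num
  have close : ∀ n ≥ N, r (y n - y N) < η / 2 := by
    intro n hn
    have h1 := step n hn
    have h2 := step N le_rfl
    set z := y n - y N with hz
    have h3 := map_sub_le_add r (y n - S h (y n) - (((h : ℝ)) : ℂ) • x)
      (y N - S h (y N) - (((h : ℝ)) : ℂ) • x)
    have e1 : y n - S h (y n) - (((h : ℝ)) : ℂ) • x - (y N - S h (y N) - (((h : ℝ)) : ℂ) • x) =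
        z - S h z := by rw [hz, map_sub]; abel
    rw [e1] at h3
    have h4 := map_add_le_add r (z - S h z) (S h z)
    rw [sub_add_cancel] at h4
    have h5 := hrS h z
    have h6 : Real.exp (-ε * h) * (1 + ε * h) ≤ 1 := by
      rw [neg_mul, Real.exp_neg, inv_mul_le_iff₀ (Real.exp_pos _), mul_one]
      linarith [Real.add_one_le_exp (ε * h)]
    have h7 : (1 - Real.exp (-ε * h)) * r z ≤
        h * (2 * (η / (4 * C) + Real.exp (-ε * 2 ^ N) * r x)) := by
      linarith
    have h8 : ε * h ≤ (1 - Real.exp (-ε * h)) * (1 + ε) := by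
      have : Real.exp (-ε * h) ≤ 1 := Real.exp_le_one_iff.2 (by
        rw [neg_mul, neg_nonpos]; positivity)
      nlinarith [mul_nonneg (sub_nonneg.2 this) (mul_nonneg hε.le (sub_nonneg.2 hh1))]
    have h9 : ε * h * r z ≤ (1 + ε) * (h * (2 * (η / (4 * C) + Real.exp (-ε * 2 ^ N) * r x))) := by
      have := mul_le_mul_of_nonneg_right h8 (apply_nonneg r z)
      have := mul_le_mul_of_nonneg_left h7 (show 0 ≤ 1 + ε by positivity)
      linarith
    have h10 : r z ≤ C * (η / (4 * C) + Real.exp (-ε * 2 ^ N) * r x) := by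
      generalize η / (4 * C) + Real.exp (-ε * 2 ^ N) * r x = E at h9
      rw [hC]
      have : r z = (ε * h * r z) / (ε * h) := by field_simp
      rw [this, div_le_iff₀ (by positivity)]
      refine h9.trans_eq ?_
      field_simp
    refine h10.trans_lt ?_
    calc C * (η / (4 * C) + Real.exp (-ε * 2 ^ N) * r x) < C * (η / (4 * C) + η / (8 * C)) := by
          gcongr
      _ = η * (3 / 8) := by field_simp; norm_num
      _ < η / 2 := by linarith
  refine ⟨N, fun n hn m hm => ?_⟩
  have h1 := close n hn
  have h2 := close m hm
  have h3 := map_sub_le_add r (y m - y N) (y n - y N)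
  rw [sub_sub_sub_cancel_right] at h3
  exact (hpr _).trans_lt (by linarith)

/-- The solution is `y = ∫₀^∞ S(s)x ds`, the limit of the Riemann sums, for which `y - S(t)y = ∫₀^t
S(s)x ds ≈ t x`. -/
theorem exists_generator_eq_neg {S : ℝ≥0 → X →L[ℂ] X} (hS : IsStronglyContinuousSemigroup S)
    (hX : ∀ u : ℕ → X, CauchySeq u → ∃ x, Tendsto u atTop (𝓝 x)) {ε : ℝ}
    (hε : 0 < ε)
    (hdecay : ∀ p : Seminorm ℂ X, Continuous p → ∃ r : Seminorm ℂ X, Continuous r ∧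
      (∀ x, p x ≤ r x) ∧ ∀ (t : ℝ≥0) x, r (S t x) ≤ Real.exp (-ε * t) * r x) (x : X) :
    ∃ y, Tendsto (fun t : ℝ≥0 => (((t : ℝ) : ℂ)⁻¹) • (S t y - y)) (𝓝[>] 0) (𝓝 (-x)) := by
  obtain ⟨y, hy⟩ := hX _ (cauchySeq_riemannSum hS hε hdecay x)
  refine ⟨y, tendsto_iff_forall_seminorm.2 fun p hp η hη => ?_⟩
  obtain ⟨r, hr, hpr, hrS⟩ := hdecay p hp
  obtain ⟨δ, hδ, hle⟩ := exists_forall_le_seminorm_sub_le hS hr x (half_pos hη)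
  filter_upwards [nhdsWithin_le_nhds (Iio_mem_nhds hδ), self_mem_nhdsWithin] with t ht ht0
  have ht0' : 0 < (t : ℝ) := ht0
  have hpow : Tendsto (fun n : ℕ => (2 : ℝ) ^ n) atTop atTop :=
    tendsto_pow_atTop_atTop_of_one_lt one_lt_two
  have hexp : Tendsto (fun n : ℕ => Real.exp (-ε * 2 ^ n) * r x) atTop (𝓝 (0 * r x)) :=
    (Real.tendsto_exp_atBot.comp
      (hpow.const_mul_atTop_of_neg (neg_lt_zero.2 hε))).mul_const _
  rw [zero_mul] at hexp
  set m : ℕ → ℕ := fun n => ⌊(t : ℝ) * 2 ^ n⌋₊ with hm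
  have hk : Tendsto (fun n : ℕ => (m n : ℝ) * (((1 / 2) ^ n : ℝ≥0) : ℝ)) atTop (𝓝 (t : ℝ)) := by
    refine ((tendsto_nat_floor_mul_div_atTop t.2).comp hpow).congr fun n => ?_
    simp [hm, div_eq_mul_inv]
  have hk' : Tendsto (fun n : ℕ => (m n : ℝ≥0) * (1 / 2) ^ n) atTop (𝓝 t) := by
    rw [← NNReal.tendsto_coe]
    simpa using hk
  have hmt : ∀ n, (m n : ℝ≥0) * (1 / 2) ^ n ≤ t := by
    intro n
    rw [← NNReal.coe_le_coe]
    push_cast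
    have : (m n : ℝ) ≤ t * 2 ^ n := Nat.floor_le (by positivity)
    calc (m n : ℝ) * (1 / 2) ^ n ≤ (t * 2 ^ n) * (1 / 2) ^ n := by gcongr
      _ = t * (2 * (1 / 2)) ^ n := by rw [mul_pow]; ring
      _ = t := by norm_num
  set u : ℕ → X := fun n : ℕ => ((((1 / 2) ^ n : ℝ≥0) : ℝ) : ℂ) •
      ∑ k ∈ Finset.range (4 ^ n), S (k * (1 / 2) ^ n) x with hu
  -- Both the time and the vector vary: the decay bound is uniform in time and handles `u n - y`,
  -- orbit continuity handles the rest.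
  have hSu : Tendsto (fun n => S (m n * (1 / 2) ^ n) (u n)) atTop (𝓝 (S t y)) := by
    have h1 : Tendsto (fun n => S (m n * (1 / 2) ^ n) (u n - y)) atTop (𝓝 0) := by
      refine tendsto_iff_forall_seminorm.2 fun p hp η hη => ?_
      obtain ⟨r, hr, hpr, hrS⟩ := hdecay p hp
      filter_upwards [tendsto_iff_forall_seminorm.1 hy r hr η hη] with n hn
      rw [sub_zero]
      refine (hpr _).trans_lt (((hrS _ _).trans ?_).trans_lt hn)
      refine mul_le_of_le_one_left (apply_nonneg _ _) (Real.exp_le_one_iff.2 ?_)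
      rw [neg_mul, neg_nonpos]
      positivity
    have h2 := ((hS.continuous_orbit y).tendsto t).comp hk'
    simpa using h1.add h2
  have main : r (y - S t y - ((t : ℝ) : ℂ) • x) ≤ t * (η / 2 + 0) := by
    refine seminorm_le_of_tendsto hr ((hy.sub hSu).sub
      (((Complex.continuous_ofReal.tendsto _).comp hk).smul_const x))
      (hk.mul (hexp.const_add (η / 2))) (Eventually.of_forall fun n => ?_)
    have h1 := seminorm_riemannSum_le hS hε hrS hle ((1 / 2) ^ n) (4 ^ n) (m n)
      ((hmt n).trans (le_of_lt ht))
    have e3 : ((4 ^ n : ℕ) : ℝ) * (((1 / 2) ^ n : ℝ≥0) : ℝ) = 2 ^ n := by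
      push_cast
      rw [← mul_pow]
      norm_num
    rw [e3] at h1
    exact h1
  have hne : ((t : ℝ) : ℂ) ≠ 0 := by exact_mod_cast ht0'.ne'
  have h2 : (((t : ℝ) : ℂ)⁻¹) • (S t y - y) - -x =
      (-((t : ℝ) : ℂ)⁻¹) • (y - S t y - ((t : ℝ) : ℂ) • x) := by
    rw [smul_sub _ (y - S t y), neg_smul _ (((t : ℝ) : ℂ) • x), inv_smul_smul₀ hne]
    module
  refine (hpr _).trans_lt ?_
  rw [h2, map_smul_eq_mul, norm_neg, norm_inv, Complex.norm_real, Real.norm_of_nonneg ht0'.le,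
    inv_mul_lt_iff₀ ht0']
  refine main.trans_lt ?_
  gcongr
  linarith

end Decay

/-! ### Resolvents in terms of the graph -/

section ResolventLemmas

variable {X : Type*} [AddCommGroup X] [Module ℂ X] {A : X →ₗ.[ℂ] X} {z : ℂ}

theorem resolvent_mem_graph (hz : z ∈ resolventSet A) (x : X) :
    (resolvent A z x, z • resolvent A z x - x) ∈ A.graph := by
  have hz' : Function.Bijective (shifted A z) := hz
  rw [resolvent, dif_pos hz']
  set y := (LinearEquiv.ofBijective (shifted A z) hz').symm x with hy
  have h1 : shifted A z y = x := (LinearEquiv.ofBijective (shifted A z) hz').apply_symm_apply x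
  have h2 : z • (y : X) - A y = x := h1
  have h3 : z • (y : X) - x = A y := by rw [← h2, sub_sub_cancel]
  change ((y : X), z • (y : X) - x) ∈ A.graph
  rw [h3]
  exact A.mem_graph y

theorem resolvent_apply_of_mem_graph (hz : z ∈ resolventSet A) {x y : X}
    (h : (x, y) ∈ A.graph) : resolvent A z (z • x - y) = x := by
  have hz' : Function.Bijective (shifted A z) := hz
  obtain ⟨w, rfl, rfl⟩ := (A.mem_graph_iff).1 h
  rw [resolvent, dif_pos hz']
  change (((LinearEquiv.ofBijective (shifted A z) hz').symm (shifted A z w) : A.domain) : X) = w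
  exact congrArg _ ((LinearEquiv.ofBijective (shifted A z) hz').symm_apply_apply w)

theorem mem_resolventSet_of_graph
    (hinj : ∀ x, (x, z • x) ∈ A.graph → x = 0)
    (hsurj : ∀ x, ∃ y, (y, z • y - x) ∈ A.graph) : z ∈ resolventSet A := by
  constructor
  · rw [← LinearMap.ker_eq_bot, LinearMap.ker_eq_bot']
    intro w hw
    have hw' : z • (w : X) - A w = 0 := hw
    have h := A.mem_graph w
    rw [← sub_eq_zero.1 hw'] at h
    exact Subtype.ext (hinj _ h)
  · intro x
    obtain ⟨y, hy⟩ := hsurj x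
    obtain ⟨w, hw, hAw⟩ := (A.mem_graph_iff).1 hy
    refine ⟨w, ?_⟩
    change z • (w : X) - A w = x
    rw [hAw]
    simp only at hw ⊢
    rw [hw, sub_sub_cancel]

theorem mem_graph_iff_resolvent (hz : z ∈ resolventSet A) {x y : X} :
    (x, y) ∈ A.graph ↔ resolvent A z (z • x - y) = x := by
  refine ⟨resolvent_apply_of_mem_graph hz, fun h => ?_⟩
  have := resolvent_mem_graph hz (z • x - y)
  rwa [h, sub_sub_cancel] at this

theorem isClosed_of_continuous_resolvent [TopologicalSpace X] [T2Space X]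
    [IsTopologicalAddGroup X] [ContinuousConstSMul ℂ X] (hz : z ∈ resolventSet A)
    (h : Continuous (resolvent A z)) : A.IsClosed := by
  have : (A.graph : Set (X × X)) = {w | resolvent A z (z • w.1 - w.2) = w.1} := by
    ext ⟨x, y⟩
    exact mem_graph_iff_resolvent hz
  rw [LinearPMap.IsClosed, this]
  exact isClosed_eq (by fun_prop) continuous_fst

theorem seminorm_pow_le_of_le (r : Seminorm ℂ X) {f : Module.End ℂ X} (hf : ∀ x, r (f x) ≤ r x)
    (n : ℕ) (x : X) : r ((f ^ n) x) ≤ r x := by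
  induction n with
  | zero => simp
  | succ n ih =>
    rw [pow_succ', Module.End.mul_apply]
    exact (hf _).trans ih

end ResolventLemmas

/-! ### The equivalences -/

section HilleYosida

variable {X : Type*} [AddCommGroup X] [Module ℂ X] [UniformSpace X] [IsUniformAddGroup X]
  [ContinuousSMul ℂ X] {ν : Seminorm ℂ X} {A : X →ₗ.[ℂ] X} {M ω : ℝ}
  {T : ℝ≥0 → X →L[ℂ] X}

theorem exists_seminorm_le_of_forall_contSeminorms (hν : IsTypeB ν) (hM : 0 ≤ M) {ι : Type*}
    {F : ι → X → X} {c : ι → ℝ}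
    (h : ∀ p ∈ contSeminorms ν, ∃ q ∈ contSeminorms ν, ∀ i x, c i * p (F i x) ≤ M * q x)
    {p : Seminorm ℂ X} (hp : Continuous p) :
    ∃ q : Seminorm ℂ X, Continuous q ∧ ∀ i x, c i * p (F i x) ≤ q x := by
  obtain ⟨C, hC, hmem⟩ := exists_smul_mem_contSeminorms hν hp
  obtain ⟨q, hq, hpq⟩ := h _ hmem
  obtain ⟨e, he⟩ : ∃ e : ℝ≥0, (e : ℝ) = M := ⟨⟨M, hM⟩, rfl⟩
  refine ⟨C • e • q, (hq.1.const_smul _).const_smul _, fun i x => ?_⟩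
  have h1 : c i * ((C : ℝ)⁻¹ * p (F i x)) ≤ M * q x := hpq i x
  have hC' : 0 < (C : ℝ) := hC
  change c i * p (F i x) ≤ C * (e * q x)
  rw [he]
  calc c i * p (F i x) = C * (c i * ((C : ℝ)⁻¹ * p (F i x))) := by field_simp
    _ ≤ _ := by gcongr

theorem IsTypeStar.exists_seminorm_le (hν : IsTypeB ν) (hM : 1 ≤ M) (hT : IsTypeStar ν M ω T)
    {p : Seminorm ℂ X} (hp : Continuous p) : ∃ q : Seminorm ℂ X, Continuous q ∧
      ∀ (x : X) (t : ℝ≥0), Real.exp (-ω * t) * p (T t x) ≤ q x := by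
  obtain ⟨q, hq, h⟩ := exists_seminorm_le_of_forall_contSeminorms hν (zero_le_one.trans hM)
    (F := fun t x => T t x) (c := fun t : ℝ≥0 => Real.exp (-ω * t))
    (fun p hp => by
      obtain ⟨q, hq, h⟩ := hT p hp
      exact ⟨q, hq, fun t x => h x t⟩) hp
  exact ⟨q, hq, fun x t => h t x⟩

theorem exists_isTypeStar_of_isQuasiEquicontinuous [PolynormableSpace ℂ X]
    (hν : IsTypeB ν) (hT : IsStronglyContinuousSemigroup T) (h : IsQuasiEquicontinuous T) :
    ∃ M ω : ℝ, 1 ≤ M ∧ IsTypeStar ν M ω T := by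
  obtain ⟨ω, hω⟩ := h
  obtain ⟨C, hC⟩ := exists_norm_le_of_forall_seminorm hν
    (s := {y | ∃ (x : X) (t : ℝ≥0), ν x ≤ 1 ∧ y = (Real.exp (-ω * t) : ℂ) • T t x}) (fun p hp => by
      obtain ⟨q, hq, hpq⟩ := hω p hp
      obtain ⟨C, hC, hqC⟩ := exists_le_mul_norm hν hq
      refine ⟨C, ?_⟩
      rintro _ ⟨x, t, hx, rfl⟩
      rw [map_smul_eq_mul, Complex.norm_real, Real.norm_of_nonneg (Real.exp_pos _).le]
      exact (hpq x t).trans ((hqC x).trans (mul_le_of_le_one_right hC.le hx)))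
  -- `C` bounds the norm of the weighted orbits of the unit ball, which are `τ`-bounded and hence
  -- norm bounded.
  set M := max C 1 with hM
  have hM0 : 0 < M := lt_of_lt_of_le one_pos (le_max_right _ _)
  have hνT : ∀ (x : X) (t : ℝ≥0), Real.exp (-ω * t) * ν (T t x) ≤ M * ν x := by
    intro x t
    rcases (apply_nonneg ν x).eq_or_lt with h0 | h0
    · simp [hν.eq_zero_of_norm_eq_zero x h0.symm]
    · have h1 := hC _ ⟨(((ν x)⁻¹ : ℝ) : ℂ) • x, t, by
        rw [map_smul_eq_mul, Complex.norm_real, Real.norm_of_nonneg (by positivity),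
          inv_mul_cancel₀ h0.ne'], rfl⟩
      rw [map_smul (T t), map_smul_eq_mul, map_smul_eq_mul, Complex.norm_real, Complex.norm_real,
        Real.norm_of_nonneg (Real.exp_pos _).le, Real.norm_of_nonneg (by positivity)] at h1
      have h2 := h1.trans (le_max_left C 1)
      calc Real.exp (-ω * t) * ν (T t x)
          = (Real.exp (-ω * t) * ((ν x)⁻¹ * ν (T t x))) * ν x := by field_simp
        _ ≤ M * ν x := by gcongr
  refine ⟨M, ω, le_max_right _ _, fun p hp => ?_⟩
  obtain ⟨q, hq, hpq⟩ := hω p hp.1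
  obtain ⟨r, hr, hpr, hrq, hrc, hrT⟩ := exists_contractive_seminorm hT hq hpq
  obtain ⟨e, he⟩ : ∃ e : ℝ≥0, (e : ℝ) = M⁻¹ := ⟨⟨M⁻¹, by positivity⟩, rfl⟩
  have her : ∀ x, (e • r) x = M⁻¹ * r x := fun x => by rw [← he]; rfl
  -- The witness is `r / M`: since `p ≤ ν`, each term of the supremum defining `r` is at most `M ν
  -- x`, so `r / M` lies in `𝒩`.
  refine ⟨e • r, ⟨hr.const_smul _, fun x => ?_⟩, fun x t => ?_⟩
  · rw [her, inv_mul_le_iff₀ hM0]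
    refine hrc x _ fun t => le_trans ?_ (hνT x t)
    gcongr
    exact hp.2 _
  · rw [her, mul_inv_cancel_left₀ hM0.ne']
    have h1 := (hpr (T t x)).trans (hrT t x)
    calc Real.exp (-ω * t) * p (T t x) ≤ Real.exp (-ω * t) * (Real.exp (ω * t) * r x) := by gcongr
      _ = r x := by rw [← mul_assoc, ← Real.exp_add]; simp

theorem eq_zero_of_generator_eq_smul [PolynormableSpace ℂ X] (hν : IsTypeB ν) (hM : 1 ≤ M)
    (hT : IsStronglyContinuousSemigroup T) (hTM : IsTypeStar ν M ω T) {l : ℂ} (hl : ω < l.re)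
    {x : X}
    (hx : Tendsto (fun t : ℝ≥0 => (((t : ℝ) : ℂ)⁻¹) • (T t x - x)) (𝓝[>] 0) (𝓝 (l • x))) :
    x = 0 := by
  refine eq_zero_of_forall_seminorm hν fun p hp => ?_
  obtain ⟨q, hq, hpq⟩ := hTM.exists_seminorm_le hν hM hp
  obtain ⟨r, hr, hpr, -, -, hrT⟩ := exists_contractive_seminorm hT hq hpq
  have h := dissipative_of_contractive hr hrT hx l
  rw [sub_self, map_zero] at h
  have h1 : r x ≤ 0 := by
    by_contra! h0
    exact absurd h (not_le.2 (mul_pos (sub_pos.2 hl) h0))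
  exact le_antisymm ((hpr x).trans h1) (apply_nonneg _ _)

theorem mem_resolventSet_of_generator [PolynormableSpace ℂ X] (hν : IsTypeB ν) (hM : 1 ≤ M)
    (hT : IsStronglyContinuousSemigroup T) (hTM : IsTypeStar ν M ω T) (hA : IsGenerator A T)
    {l : ℂ} (hl : ω < l.re) : l ∈ resolventSet A := by
  refine mem_resolventSet_of_graph (fun x hx => ?_) fun x => ?_
  · exact eq_zero_of_generator_eq_smul hν hM hT hTM hl ((hA _ _).1 hx)
  · obtain ⟨y, hy⟩ := exists_generator_eq_neg (hT.rescale (-l)) hν.seq_complete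
      (sub_pos.2 hl) (fun p hp => by
        obtain ⟨q, hq, hpq⟩ := hTM.exists_seminorm_le hν hM hp
        obtain ⟨r, hr, hpr, -, -, hrT⟩ := exists_contractive_seminorm hT hq hpq
        refine ⟨r, hr, hpr, fun t x => ?_⟩
        rw [seminorm_rescale]
        calc Real.exp ((-l).re * t) * r (T t x)
            ≤ Real.exp ((-l).re * t) * (Real.exp (ω * t) * r x) := by
              gcongr
              exact hrT t x
          _ = Real.exp (-(l.re - ω) * t) * r x := by
              rw [← mul_assoc, ← Real.exp_add, Complex.neg_re]
              ring_nf) x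
    refine ⟨y, (hA _ _).2 ?_⟩
    have := tendsto_rescale l hy
    rwa [rescale_neg_rescale, neg_add_eq_sub] at this

omit [ContinuousSMul ℂ X] in
theorem seminorm_resolvent_le {r : Seminorm ℂ X} (hr : Continuous r)
    (hrT : ∀ (t : ℝ≥0) x, r (T t x) ≤ Real.exp (ω * t) * r x) (hA : IsGenerator A T)
    {l : ℂ} (hl : l ∈ resolventSet A) (x : X) : (l.re - ω) * r (resolvent A l x) ≤ r x := by
  have := dissipative_of_contractive hr hrT ((hA _ _).1 (resolvent_mem_graph hl x)) l
  rwa [sub_sub_cancel] at this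

/-- Every `x` is `l y - A y` for some `y` in the domain, hence the limit of `l y - (T(t)y - y)/t`,
which stays in the domain. -/
theorem dense_domain_of_generator [PolynormableSpace ℂ X] (hν : IsTypeB ν) (hM : 1 ≤ M)
    (hT : IsStronglyContinuousSemigroup T) (hTM : IsTypeStar ν M ω T) (hA : IsGenerator A T) :
    Dense (A.domain : Set X) := by
  intro x
  have hl : ω < ((ω + 1 : ℝ) : ℂ).re := by simp
  have hρ := mem_resolventSet_of_generator hν hM hT hTM hA hl
  have hg := resolvent_mem_graph hρ x
  set l : ℂ := ((ω + 1 : ℝ) : ℂ)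
  set y := resolvent A l x
  have hy := (hA _ _).1 hg
  have hlim := hy.const_sub (l • y)
  rw [sub_sub_cancel] at hlim
  refine mem_closure_of_tendsto hlim (Eventually.of_forall fun t => ?_)
  have hyD : y ∈ A.domain := LinearPMap.mem_domain_of_mem_graph hg
  have hTy : T t y ∈ A.domain := by
    refine LinearPMap.mem_domain_of_mem_graph ((hA _ (T t (l • y - x))).2 ?_)
    refine (((T t).continuous.tendsto _).comp hy).congr fun s => ?_
    rw [Function.comp_apply, map_smul, map_sub, ← ContinuousLinearMap.comp_apply, ← hT.map_add,
      ← ContinuousLinearMap.comp_apply, ← hT.map_add, add_comm]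
  exact A.domain.sub_mem (A.domain.smul_mem _ hyD)
    (A.domain.smul_mem _ (A.domain.sub_mem hTy hyD))

theorem GeneratesTypeStar.complexHilleYosida [PolynormableSpace ℂ X] (hν : IsTypeB ν)
    (hM : 1 ≤ M) (h : GeneratesTypeStar ν A M ω) : ComplexHilleYosida ν A M ω := by
  obtain ⟨T, hT, hTM, hA⟩ := h
  have := hν.t2Space
  have hρ : ∀ l : ℂ, ω < l.re → l ∈ resolventSet A := fun l hl =>
    mem_resolventSet_of_generator hν hM hT hTM hA hl
  refine ⟨?_, dense_domain_of_generator hν hM hT hTM hA, hρ, fun p hp => ?_⟩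
  · have hl := hρ ((ω + 1 : ℝ) : ℂ) (by simp)
    refine isClosed_of_continuous_resolvent hl (continuous_of_forall_seminorm _ fun p hp => ?_)
    obtain ⟨q, hq, hpq⟩ := hTM.exists_seminorm_le hν hM hp
    obtain ⟨r, hr, hpr, -, -, hrT⟩ := exists_contractive_seminorm hT hq hpq
    exact ⟨r, hr, fun x => (hpr _).trans (by simpa using seminorm_resolvent_le hr hrT hA hl x)⟩
  · obtain ⟨q, hq, hpq⟩ := hTM p hp
    obtain ⟨e, he⟩ : ∃ e : ℝ≥0, (e : ℝ) = M := ⟨⟨M, by positivity⟩, rfl⟩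
    have heq : ∀ x, (e • q) x = M * q x := fun x => by rw [← he]; rfl
    obtain ⟨r, hr, hpr, hrq, -, hrT⟩ := exists_contractive_seminorm hT (hq.1.const_smul e)
      (p := p) (q := e • q) fun x t => (hpq x t).trans_eq (heq x).symm
    refine ⟨q, hq, fun x n l hn hl => ?_⟩
    rw [← heq]
    refine (hpr _).trans (le_trans (seminorm_pow_le_of_le r (fun y => ?_) n x) (hrq x))
    have hn' : (0 : ℝ) < n := by exact_mod_cast hn
    have hpos : 0 < n * (l.re - ω) := mul_pos hn' (sub_pos.2 hl)
    have hre : ((ω : ℂ) + n * (l - ω)).re - ω = n * (l.re - ω) := by simp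
    have h1 := seminorm_resolvent_le hr hrT hA (hρ ((ω : ℂ) + n * (l - ω)) (by linarith)) y
    rw [LinearMap.smul_apply, map_smul_eq_mul, Complex.norm_real, Real.norm_of_nonneg hpos.le]
    rwa [hre] at h1

omit [IsUniformAddGroup X] [ContinuousSMul ℂ X] in
theorem ComplexHilleYosida.realHilleYosida (h : ComplexHilleYosida ν A M ω) :
    RealHilleYosida ν A M ω := by
  obtain ⟨hc, hd, hρ, hb⟩ := h
  refine ⟨hc, hd, fun l hl => hρ l (by simpa using hl), fun p hp => ?_⟩
  obtain ⟨q, hq, hpq⟩ := hb p hp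
  refine ⟨q, hq, fun x n l hn hl => ?_⟩
  have := hpq x n l hn (by simpa using hl)
  rw [Complex.ofReal_re] at this
  convert this using 6
  push_cast
  rfl

/-- The approximations `2ⁿ R(ω + 2ⁿ)` of the identity. -/
noncomputable def dyadicResolvent (A : X →ₗ.[ℂ] X) (ω : ℝ) (n : ℕ) : Module.End ℂ X :=
  (2 : ℂ) ^ n • resolvent A ((ω + 2 ^ n : ℝ) : ℂ)

omit [UniformSpace X] [IsUniformAddGroup X] [ContinuousSMul ℂ X] in
theorem seminorm_dyadicResolvent_pow_le {p q : Seminorm ℂ X}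
    (h : ∀ (x : X) (n : ℕ) (l : ℝ), 1 ≤ n → ω < l →
      p (((((n * (l - ω) : ℝ) : ℂ) • resolvent A ((ω + n * (l - ω) : ℝ) : ℂ)) ^ n) x) ≤ M * q x)
    (n : ℕ) {k : ℕ} (hk : 1 ≤ k) (x : X) : p ((dyadicResolvent A ω n ^ k) x) ≤ M * q x := by
  have hk' : (0 : ℝ) < k := by exact_mod_cast hk
  -- Taking `λ = ω + 2ⁿ/k` gives `k(λ - ω) = 2ⁿ`, so the Hille-Yosida bound controls every positive
  -- power of one and the same operator.
  have h1 := h x k (ω + 2 ^ n / k) hk (by linarith [show (0 : ℝ) < 2 ^ n / k by positivity])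
  rw [add_sub_cancel_left, mul_div_cancel₀ _ hk'.ne'] at h1
  rw [dyadicResolvent]
  convert h1 using 5
  push_cast
  rfl

theorem RealHilleYosida.isResolventSequence (hν : IsTypeB ν) (hM : 1 ≤ M)
    (h : RealHilleYosida ν A M ω) :
    IsResolventSequence (fun x y => (x, y + (ω : ℂ) • x) ∈ A.graph) (dyadicResolvent A ω) := by
  obtain ⟨-, hd, hρ, hb⟩ := h
  have hρ' : ∀ n : ℕ, ((ω + 2 ^ n : ℝ) : ℂ) ∈ resolventSet A := fun n =>
    hρ _ (by linarith [show (0 : ℝ) < 2 ^ n by positivity])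
  refine ⟨fun n x => ?_, fun n x y hxy => ?_, fun p hp => ?_, ?_⟩
  · have h1 := A.graph.smul_mem ((2 : ℂ) ^ n) (resolvent_mem_graph (hρ' n) x)
    convert h1 using 1
    rw [Prod.smul_mk, Prod.mk.injEq]
    refine ⟨rfl, ?_⟩
    rw [dyadicResolvent, LinearMap.smul_apply]
    push_cast
    module
  · have h1 := resolvent_apply_of_mem_graph (hρ' n) hxy
    have h2 : ((ω + 2 ^ n : ℝ) : ℂ) • x - (y + (ω : ℂ) • x) = (2 : ℂ) ^ n • x - y := by
      push_cast
      module
    rw [h2, map_sub, map_smul, sub_eq_iff_eq_add] at h1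
    rw [dyadicResolvent, LinearMap.smul_apply, LinearMap.smul_apply,
      inv_smul_smul₀ (pow_ne_zero _ two_ne_zero), h1]
  · obtain ⟨q, hq, hpq⟩ := exists_seminorm_le_of_forall_contSeminorms hν (zero_le_one.trans hM)
      (F := fun (i : ℕ × {k : ℕ // 1 ≤ k}) x => (dyadicResolvent A ω i.1 ^ i.2.1) x)
      (c := fun _ => 1) (fun p hp => by
        obtain ⟨q, hq, hpq⟩ := hb p hp
        refine ⟨q, hq, fun i x => ?_⟩
        rw [one_mul]
        exact seminorm_dyadicResolvent_pow_le hpq _ i.2.2 x) hp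
    -- Adding `p` covers the power `k = 0`, which the Hille-Yosida bound omits.
    refine ⟨p + q, hp.add hq, fun n k x => ?_⟩
    rw [add_apply]
    rcases Nat.eq_zero_or_pos k with rfl | hk
    · simp
    · have h1 := hpq (n, ⟨k, hk⟩) x
      rw [one_mul] at h1
      exact h1.trans (le_add_of_nonneg_left (apply_nonneg _ _))
  · refine hd.mono fun x hx => ?_
    obtain ⟨y, hy⟩ := LinearPMap.mem_domain_iff.1 hx
    exact ⟨y - (ω : ℂ) • x, by rwa [sub_add_cancel]⟩

theorem RealHilleYosida.generatesTypeStar [PolynormableSpace ℂ X] (hν : IsTypeB ν)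
    (hM : 1 ≤ M) (h : RealHilleYosida ν A M ω) : GeneratesTypeStar ν A M ω := by
  have := hν.t2Space
  have hJ := h.isResolventSequence hν hM
  choose S hS using fun t => hJ.exists_limit hν.seq_complete t
  have hSC := hJ.isStronglyContinuousSemigroup_limit hS
  obtain ⟨-, -, hρ, hb⟩ := h
  have hT : IsTypeStar ν M ω (rescale ω S) := by
    intro p hp
    obtain ⟨q, hq, hpq⟩ := hb p hp
    have hpos : ∀ (x : X) (t : ℝ≥0), 0 < t → p (S t x) ≤ M * q x := by
      intro x t ht
      refine seminorm_le_of_tendsto hp.1 (hS t x) tendsto_const_nhds ?_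
      have hev : ∀ᶠ n : ℕ in atTop, 1 / (t : ℝ) ≤ (2 : ℝ) ^ n :=
        (tendsto_pow_atTop_atTop_of_one_lt one_lt_two).eventually_ge_atTop _
      filter_upwards [hev] with n hn
      refine seminorm_dyadicResolvent_pow_le hpq n (Nat.le_floor ?_) x
      rw [div_le_iff₀ (NNReal.coe_pos.2 ht)] at hn
      push_cast
      linarith
    refine ⟨q, hq, fun x t => ?_⟩
    rw [seminorm_rescale, Complex.ofReal_re, ← mul_assoc, ← Real.exp_add, neg_mul,
      neg_add_cancel, Real.exp_zero, one_mul]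
    -- At `t = 0` every exponent is `0`, so the sharp bound `M q` is recovered by letting `t ↓ 0`.
    rcases (zero_le : 0 ≤ t).eq_or_lt with rfl | ht
    · refine seminorm_le_of_tendsto hp.1 (((hSC.continuous_orbit x).tendsto 0).mono_left
        (nhdsWithin_le_nhds (s := Set.Ioi 0))) tendsto_const_nhds ?_
      filter_upwards [self_mem_nhdsWithin] with s hs using hpos x s hs
    · exact hpos x t ht
  have hgen : ∀ x y, (x, y) ∈ A.graph → Tendsto
      (fun t : ℝ≥0 => (((t : ℝ) : ℂ)⁻¹) • (rescale ω S t x - x)) (𝓝[>] 0) (𝓝 y) := by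
    intro x y hxy
    have h1 := tendsto_rescale ω (hJ.tendsto_limit_slope_zero hS (x := x) (y := y - (ω : ℂ) • x)
      (by rwa [sub_add_cancel]))
    rwa [sub_add_cancel] at h1
  refine ⟨rescale ω S, hSC.rescale ω, hT, fun x y => ⟨hgen x y, fun hxy => ?_⟩⟩
  have hl := hρ (ω + 1) (by linarith)
  set l : ℂ := ((ω + 1 : ℝ) : ℂ) with hl'
  have hz := hgen _ _ (resolvent_mem_graph hl (l • x - y))
  rw [mem_graph_iff_resolvent hl]
  set z := resolvent A l (l • x - y)
  -- `z` in the domain of `A` and `x` in that of the generator have the same image under `l` minus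
  -- the generator, which is injective.
  have h1 : z - x = 0 := by
    refine eq_zero_of_generator_eq_smul hν hM (hSC.rescale ω) hT (l := l) (by simp [hl']) ?_
    have h2 := hz.sub hxy
    have h3 : l • z - (l • x - y) - y = l • (z - x) := by module
    rw [h3] at h2
    refine h2.congr fun t => ?_
    rw [map_sub]
    module
  exact sub_eq_zero.1 h1

theorem generatesQuasiEquicontinuous_iff [PolynormableSpace ℂ X] (hν : IsTypeB ν) :
    GeneratesQuasiEquicontinuous A ↔ ∃ M ω : ℝ, 1 ≤ M ∧ GeneratesTypeStar ν A M ω := by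
  constructor
  · rintro ⟨T, hT, hq, hA⟩
    obtain ⟨M, ω, hM, hTM⟩ := exists_isTypeStar_of_isQuasiEquicontinuous hν hT hq
    exact ⟨M, ω, hM, T, hT, hTM, hA⟩
  · rintro ⟨M, ω, hM, T, hT, hTM, hA⟩
    exact ⟨T, hT, ⟨ω, fun p hp => hTM.exists_seminorm_le hν hM hp⟩, hA⟩

end HilleYosida

end LCSemigroup

theorem mainTheorem2 {X : Type*} [AddCommGroup X] [Module ℂ X] [UniformSpace X]
    [IsUniformAddGroup X] [ContinuousSMul ℂ X] [LocallyConvexSpace ℝ X]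
    (ν : Seminorm ℂ X) (hν : LCSemigroup.IsTypeB ν) (A : X →ₗ.[ℂ] X) :
    (∀ M ω : ℝ, 1 ≤ M →
      List.TFAE [
        LCSemigroup.GeneratesTypeStar ν A M ω,
        LCSemigroup.RealHilleYosida ν A M ω,
        LCSemigroup.ComplexHilleYosida ν A M ω]) ∧
    List.TFAE [
      ∃ M ω : ℝ, 1 ≤ M ∧ LCSemigroup.GeneratesTypeStar ν A M ω,
      ∃ M ω : ℝ, 1 ≤ M ∧ LCSemigroup.RealHilleYosida ν A M ω,
      ∃ M ω : ℝ, 1 ≤ M ∧ LCSemigroup.ComplexHilleYosida ν A M ω,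
      LCSemigroup.GeneratesQuasiEquicontinuous A] := by
  have := LCSemigroup.polynormableSpace_of_locallyConvexSpace_real (X := X)
  refine ⟨fun M ω hM => ?_, ?_⟩
  · tfae_have 1 → 3 := fun h => h.complexHilleYosida hν hM
    tfae_have 3 → 2 := fun h => h.realHilleYosida
    tfae_have 2 → 1 := fun h => h.generatesTypeStar hν hM
    tfae_finish
  · tfae_have 1 → 3 := fun ⟨M, ω, hM, h⟩ => ⟨M, ω, hM, h.complexHilleYosida hν hM⟩
    tfae_have 3 → 2 := fun ⟨M, ω, hM, h⟩ => ⟨M, ω, hM, h.realHilleYosida⟩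
    tfae_have 2 → 1 := fun ⟨M, ω, hM, h⟩ => ⟨M, ω, hM, h.generatesTypeStar hν hM⟩
    tfae_have 4 ↔ 1 := LCSemigroup.generatesQuasiEquicontinuous_iff hν
    tfae_finish
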